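/- Let $\mathsf X$ be a measurable space with a ($\sigma$-finite or, more generally, s-finite) dominating measure $dx$, let $\pi(dx)=\pi(x)\,dx$ be a probability distribution on $\mathsf X$ and let $Q(x,dx')=q(x,x')\,dx'$ be a Markov (proposal) kernel. Let $1\le s\le m$ be integers and, for every $x\in\mathsf X$, let $W_1,\dots,W_m$ be exchangeable $[0,\infty)$-valued random variables with mean $1$, whose joint law $q_x$ depends measurably on $x$. For $1\le r\le m$ denote by $q_x^{(r)}$ the law of $(W_1,\dots,W_r)$ under $q_x$, and write $\bar w=(w_1+\dots+w_r)/r$ for $w\in[0,\infty)^r$. The pseudo-marginal kernel $P_r$ on $\mathsf X\times[0,\infty)^r$ is the Metropolis--Hastings kernel which, from $(x,w)$, proposes $(x',w')\sim q(x,x')\,dx'\,q^{(r)}_{x'}(dw')$ and accepts it with probability $$1\wedge\Big\{\frac{\pi(x')\,q(x',x)}{\pi(x)\,q(x,x')}\,\frac{\bar w'}{\bar w}\Big\},$$ staying at $(x,w)$ otherwise; it is reversible with respect to $\tilde\pi_r(dx,dw)=\pi(dx)\,q^{(r)}_x(dw)\,\bar w$. For $\phi\in L^2(\pi)$ let $$\operatorname{var}(\phi,P_r)=\lim_{n\to\infty}\operatorname{Var}\Big\{n^{-1/2}\sum_{k=1}^n\phi(X_k)\Big\}\in[0,\infty],$$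 where $(X_k,\underline W_k)_{k\ge0}$ is the Markov chain with kernel $P_r$ and $(X_0,\underline W_0)\sim\tilde\pi_r$. Suppose that $P_m$ is positive, i.e. $\langle f,P_mf\rangle_{\tilde\pi_m}\ge0$ for all $f\in L^2(\tilde\pi_m)$. Then, for every $\phi\in L^2(\pi)$, the limits defining $\operatorname{var}(\phi,P_s)$ and $\operatorname{var}(\phi,P_m)$ exist in $[0,\infty]$ and $$\operatorname{var}(\phi,P_s)\le\Big(\frac{2m}{s}-1\Big)\operatorname{var}(\phi,P_m).$$ -/

import Mathlib

open MeasureTheory ProbabilityTheory Filter Topology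
open scoped ENNReal NNReal

/-! ### Markov chains, asymptotic variance, positivity, accept-reject kernels -/

section General

variable {S : Type*} [MeasurableSpace S]

/-- The law on `ℕ → S` of the homogeneous Markov chain `(Z₀, Z₁, …)` with `Z₀ ∼ μ` and transition
kernel `P`. -/
noncomputable def chainLaw (μ : Measure S) (P : Kernel S S) [IsMarkovKernel P] :
    Measure (ℕ → S) :=
  Kernel.trajMeasure (X := fun _ => S) μ
    (fun n => P.comap (fun h : (∀ _ : Finset.Iic n, S) => h ⟨n, Finset.mem_Iic.2 le_rfl⟩)
      (measurable_pi_apply _))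

/-- `v ∈ [0, ∞]` is the asymptotic variance of the ergodic averages of `f` along the Markov chain
with kernel `P` started in `μ`, i.e. `v` is the limit of
`var (n ^ (-1/2) * ∑_{k = 1}^n f (Z_k))` as `n → ∞`; the limit exists and may be infinite. -/
def IsAsymptoticVariance (μ : Measure S) (P : Kernel S S) [IsMarkovKernel P] (f : S → ℝ)
    (v : ℝ≥0∞) : Prop :=
  Tendsto (fun n : ℕ =>
      evariance (fun z : ℕ → S => (√(n : ℝ))⁻¹ * ∑ k ∈ Finset.Icc 1 n, f (z k)) (chainLaw μ P))
    atTop (𝓝 v)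

/-- `P` is a positive operator on `L²(μ)`: `⟨f, P f⟩_μ ≥ 0` for every `f ∈ L²(μ)`. -/
def IsPositiveKernel (μ : Measure S) (P : Kernel S S) : Prop :=
  ∀ f : S → ℝ, MemLp f 2 μ → 0 ≤ ∫ z, f z * (∫ z', f z' ∂(P z)) ∂μ

/-- The accept-reject kernel
`P(z, dz') = {1 - α(z)} δ_z(dz') + Q(z, dz') α(z; z')`, with `α(z) = ∫ α(z; z') Q(z, dz')`. -/
noncomputable def acceptReject (Q : Kernel S S) [IsSFiniteKernel Q] (α : S → S → ℝ≥0∞) :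
    Kernel S S :=
  Kernel.withDensity Kernel.id (fun z _ => 1 - ∫⁻ z', α z z' ∂(Q z)) + Kernel.withDensity Q α

lemma acceptReject_apply (Q : Kernel S S) [IsSFiniteKernel Q] {α : S → S → ℝ≥0∞}
    (hα : Measurable (Function.uncurry α)) (z : S) :
    acceptReject Q α z =
      (1 - ∫⁻ z', α z z' ∂(Q z)) • Measure.dirac z + (Q z).withDensity (α z) := by
  have h : Measurable (Function.uncurry fun z (_ : S) => 1 - ∫⁻ z', α z z' ∂(Q z)) :=
    (measurable_const.sub hα.lintegral_kernel_prod_right).comp measurable_fst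
  rw [acceptReject, add_apply, Kernel.withDensity_apply _ h, Kernel.withDensity_apply _ hα,
    withDensity_const, Kernel.id_apply]

lemma isMarkovKernel_acceptReject (Q : Kernel S S) [IsMarkovKernel Q] {α : S → S → ℝ≥0∞}
    (hα : Measurable (Function.uncurry α)) (h1 : ∀ z z', α z z' ≤ 1) :
    IsMarkovKernel (acceptReject Q α) := by
  refine ⟨fun z => ⟨?_⟩⟩
  have h : ∫⁻ z', α z z' ∂(Q z) ≤ 1 := by
    calc ∫⁻ z', α z z' ∂(Q z) ≤ ∫⁻ _, 1 ∂(Q z) := lintegral_mono (h1 z)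
      _ = 1 := by simp
  rw [acceptReject_apply Q hα]
  simp [withDensity_apply, tsub_add_cancel_of_le h]

end General

/-! ### Pseudo-marginal Metropolis-Hastings with averages -/

/-- The data of a family of pseudo-marginal algorithms on `X` built from `m` exchangeable
unbiased estimators: a dominating measure, a target density, a proposal density and, for every
`x`, the joint law of the normalised estimators `(W₁, …, W_m)`. -/
structure PseudoMarginal (X : Type*) [MeasurableSpace X] (m : ℕ) where
  /-- the dominating measure `dx` -/
  ref : Measure X
  sFinite_ref : SFinite ref
  /-- the target density `π(x)` -/
  dens : X → ℝ≥0
  measurable_dens : Measurable dens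
  lintegral_dens : ∫⁻ x, dens x ∂ref = 1
  /-- the proposal density `q(x, x')` -/
  q : X → X → ℝ≥0
  measurable_q : Measurable (Function.uncurry q)
  lintegral_q : ∀ x, ∫⁻ x', q x x' ∂ref = 1
  /-- the joint law `q_x(dw)` of `(W₁, …, W_m)` -/
  weights : Kernel X (Fin m → ℝ≥0)
  isMarkovKernel_weights : IsMarkovKernel weights
  exchangeable : ∀ x (σ : Equiv.Perm (Fin m)),
    (weights x).map (fun w i => w (σ i)) = weights x
  lintegral_weight : ∀ x i, ∫⁻ w, w i ∂(weights x) = 1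

namespace PseudoMarginal

attribute [instance] sFinite_ref isMarkovKernel_weights

variable {X : Type*} [MeasurableSpace X] {m : ℕ} (M : PseudoMarginal X m)

/-- The target distribution `π(dx) = π(x) dx`. -/
noncomputable def target : Measure X := M.ref.withDensity (fun x => M.dens x)

/-- The proposal kernel `Q(x, dx') = q(x, x') dx'`. -/
noncomputable def proposal : Kernel X X :=
  Kernel.withDensity (Kernel.const X M.ref) (fun x x' => (M.q x x' : ℝ≥0∞))

/-- The joint law of the first `r ≤ m` estimators `(W₁, …, W_r)`. -/
noncomputable def weightLaw (r : ℕ) (hr : r ≤ m) : Kernel X (Fin r → ℝ≥0) :=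
  M.weights.map (fun w i => w (Fin.castLE hr i))

/-- The average `(w₁ + … + w_r) / r`. -/
noncomputable def avg {r : ℕ} (w : Fin r → ℝ≥0) : ℝ≥0∞ := (∑ i, (w i : ℝ≥0∞)) / r

/-- The extended target `π(dx) q_x(dw) (w₁ + … + w_r) / r` on `X × [0, ∞)^r`. -/
noncomputable def extTarget (r : ℕ) (hr : r ≤ m) : Measure (X × (Fin r → ℝ≥0)) :=
  (M.target ⊗ₘ M.weightLaw r hr).withDensity (fun z => avg z.2)

/-- The extended proposal `Q(x, dx') q_{x'}(dw')` on `X × [0, ∞)^r`. -/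
noncomputable def extProposal (r : ℕ) (hr : r ≤ m) :
    Kernel (X × (Fin r → ℝ≥0)) (X × (Fin r → ℝ≥0)) :=
  (M.proposal ⊗ₖ (M.weightLaw r hr).prodMkLeft X).comap Prod.fst measurable_fst

/-- The Metropolis-Hastings ratio `r(x, x') = π(x') q(x', x) / (π(x) q(x, x'))`. -/
noncomputable def ratio (x x' : X) : ℝ≥0∞ :=
  ((M.dens x' : ℝ≥0∞) * M.q x' x) / (M.dens x * M.q x x')

/-- The acceptance probability `1 ∧ {r(x, x') w̄' / w̄}`, with `w̄`, `w̄'` the averages. -/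
noncomputable def accept (r : ℕ) (z z' : X × (Fin r → ℝ≥0)) : ℝ≥0∞ :=
  min 1 (M.ratio z.1 z'.1 * (avg z'.2 / avg z.2))

/-- The pseudo-marginal kernel `P_r` on `X × [0, ∞)^r`. -/
noncomputable def kernel (r : ℕ) (hr : r ≤ m) :
    Kernel (X × (Fin r → ℝ≥0)) (X × (Fin r → ℝ≥0)) :=
  haveI : IsSFiniteKernel (M.extProposal r hr) := by unfold extProposal; infer_instance
  acceptReject (M.extProposal r hr) (M.accept r)

lemma measurable_avg {r : ℕ} : Measurable (avg : (Fin r → ℝ≥0) → ℝ≥0∞) := by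
  unfold avg; fun_prop

lemma measurable_accept (r : ℕ) : Measurable (Function.uncurry (M.accept r)) := by
  have hd := M.measurable_dens
  have hq := M.measurable_q
  have ha := measurable_avg (r := r)
  have h1 : Measurable fun p : (X × (Fin r → ℝ≥0)) × (X × (Fin r → ℝ≥0)) =>
      M.q p.1.1 p.2.1 := hq.comp (by fun_prop : Measurable fun p :
        (X × (Fin r → ℝ≥0)) × (X × (Fin r → ℝ≥0)) => (p.1.1, p.2.1))
  have h2 : Measurable fun p : (X × (Fin r → ℝ≥0)) × (X × (Fin r → ℝ≥0)) =>
      M.q p.2.1 p.1.1 := hq.comp (by fun_prop : Measurable fun p :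
        (X × (Fin r → ℝ≥0)) × (X × (Fin r → ℝ≥0)) => (p.2.1, p.1.1))
  simp only [Function.uncurry_def, accept, ratio]
  fun_prop

instance : IsMarkovKernel M.proposal := by
  refine ⟨fun x => ⟨?_⟩⟩
  rw [proposal, Kernel.withDensity_apply _ M.measurable_q.coe_nnreal_ennreal]
  simp [M.lintegral_q x]

instance (r : ℕ) (hr : r ≤ m) : IsMarkovKernel (M.weightLaw r hr) :=
  Kernel.IsMarkovKernel.map _ (by fun_prop)

instance (r : ℕ) (hr : r ≤ m) : IsMarkovKernel (M.extProposal r hr) := by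
  unfold extProposal; infer_instance

instance (r : ℕ) (hr : r ≤ m) : IsMarkovKernel (M.kernel r hr) :=
  isMarkovKernel_acceptReject _ (M.measurable_accept r) (fun _ _ => min_le_left _ _)

end PseudoMarginal

/-! ### Sequences of autocovariances of a reversible chain -/

/-! For a reversible chain with operator P on L², let c_k = ⟨f, P^k f⟩ be the autocovariances of the
centred function f. When finite, the asymptotic variance is 2l - c_0, where l is the limit as b ↑ 1
of the Abel means Σ c_k b^k = ⟨f, (1 - bP)⁻¹ f⟩. Such resolvent pairings can be compared through the
energies E_b(g) = ⟨g, g - bPg⟩ = (1 - b)‖g‖² + (b/2)∬(g(z) - g(z'))². If every g for P_s has a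
counterpart g' for P_m with the same pairing against f and E_b(g') ≤ κ E_b(g), then l_s ≤ κ l_m
(`abel_le_of_energy_le`). Both chains have the same c_0, and positivity of P_m makes its
autocovariances nonnegative, so c_0 ≤ l_m. Hence 2l_s - c_0 ≤ 2κ l_m - c_0 ≤ (2κ - 1)(2l_m - c_0)
(`exists_isAsymptoticVariance_le`).

The counterpart, with κ = m/s, is built as follows. Among the m weights choose one of the m cyclic
windows of length s, with probability proportional to its average, and let g' be the mean of g over
this choice (`rotAvg`). By exchangeability the random window carries the extended target with m
weights to the one with s weights, without moving x (`extTarget_eq_sum`). So pairings with functions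
of x are preserved and, by Jensen, the norm does not grow.

In the Dirichlet form only accepted moves count, and they have a symmetric density, a minimum of two
fluxes. The probability of a window times the full average is 1/m of the window's average, and that
probability is at most 1/s. Each pair of windows therefore costs a factor 1/(ms)
(`moveDensity_mul_rotProb_le`), and the m² pairs add up to m/s (`lintegral_rotAvg_sub_sq_le`). -/

lemma tendsto_atTop_of_even_of_odd {α : Type*} {u : ℕ → α} {l : Filter α}
    (he : Tendsto (fun k => u (2 * k)) atTop l) (ho : Tendsto (fun k => u (2 * k + 1)) atTop l) :
    Tendsto u atTop l := by
  intro t ht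
  obtain ⟨a, ha⟩ := eventually_atTop.1 (he ht)
  obtain ⟨b, hb⟩ := eventually_atTop.1 (ho ht)
  refine eventually_atTop.2 ⟨2 * (a + b), fun n hn => ?_⟩
  rcases Nat.even_or_odd' n with ⟨k, rfl | rfl⟩
  · exact ha k (by omega)
  · exact hb k (by omega)

/-- The properties of the sequence `k ↦ ⟪f, P ^ k f⟫` for a self-adjoint contraction `P` from
which the existence of the asymptotic variance follows. -/
structure IsAutocovariance (c : ℕ → ℝ) : Prop where
  even_nonneg : ∀ k, 0 ≤ c (2 * k)
  even_anti : ∀ k, c (2 * (k + 1)) ≤ c (2 * k)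
  pair_nonneg : ∀ k, 0 ≤ c (2 * k) + c (2 * k + 1)
  abs_le : ∀ k, |c k| ≤ c 0

namespace IsAutocovariance

variable {c : ℕ → ℝ} 

lemma sum_range_even_mono (hc : IsAutocovariance c) :
    Monotone fun K => ∑ k ∈ Finset.range (2 * K), c k := by
  refine monotone_nat_of_le_succ fun K => ?_
  have h := hc.pair_nonneg K
  rw [mul_add, mul_one, Finset.sum_range_succ, Finset.sum_range_succ]
  linarith

lemma sum_range_even_nonneg (hc : IsAutocovariance c) (K : ℕ) :
    0 ≤ ∑ k ∈ Finset.range (2 * K), c k := by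
  simpa using hc.sum_range_even_mono (Nat.zero_le K)

lemma exists_tendsto_even (hc : IsAutocovariance c) : ∃ L, Tendsto (fun k => c (2 * k)) atTop (𝓝 L) :=
  ⟨_, tendsto_atTop_ciInf (antitone_nat_of_succ_le hc.even_anti)
    ⟨0, by rintro _ ⟨k, rfl⟩; exact hc.even_nonneg k⟩⟩

/-- If the even partial sums are bounded, the means of consecutive partial sums converge. -/
lemma exists_tendsto_mean_sum (hc : IsAutocovariance c) {B : ℝ}
    (hB : ∀ K, ∑ k ∈ Finset.range (2 * K), c k ≤ B) :
    ∃ l, Tendsto (fun N => (∑ k ∈ Finset.range N, c k + ∑ k ∈ Finset.range (N + 1), c k) / 2)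
      atTop (𝓝 l) := by
  obtain ⟨L, hL⟩ := hc.exists_tendsto_even
  have hS := tendsto_atTop_ciSup hc.sum_range_even_mono ⟨B, by rintro _ ⟨k, rfl⟩; exact hB k⟩
  set S := ⨆ K, ∑ k ∈ Finset.range (2 * K), c k
  -- The partial sums themselves may oscillate: even ones tend to S, odd ones to S + L. Averaging
  -- two neighbours removes the oscillation.
  refine ⟨S + L / 2, tendsto_atTop_of_even_of_odd ?_ ?_⟩
  · refine (hS.add (hL.div_const 2)).congr fun K => ?_
    rw [Finset.sum_range_succ]; ring
  · have h1 := ((hS.add hL).add (hS.comp (tendsto_add_atTop_nat 1))).div_const 2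
    rw [show (S + L + S) / 2 = S + L / 2 by ring] at h1
    refine h1.congr fun K => ?_
    simp only [Function.comp_apply, Finset.sum_range_succ, mul_add, mul_one]

lemma sum_range_le (hc : IsAutocovariance c) {B : ℝ}
    (hB : ∀ K, ∑ k ∈ Finset.range (2 * K), c k ≤ B) (N : ℕ) :
    |∑ k ∈ Finset.range N, c k| ≤ B + c 0 := by
  have h0 := hc.even_nonneg 0
  rcases Nat.even_or_odd' N with ⟨k, rfl | rfl⟩
  · rw [abs_of_nonneg (hc.sum_range_even_nonneg k)]
    linarith [hB k]
  · rw [Finset.sum_range_succ, abs_of_nonneg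
      (add_nonneg (hc.sum_range_even_nonneg k) (hc.even_nonneg k))]
    linarith [hB k, (_root_.abs_le.1 (hc.abs_le (2 * k))).2]

/-- In the bounded case the Cesàro means of the partial sums converge to the same limit. -/
lemma tendsto_cesaro (hc : IsAutocovariance c) {B l : ℝ}
    (hB : ∀ K, ∑ k ∈ Finset.range (2 * K), c k ≤ B)
    (hl : Tendsto (fun N => (∑ k ∈ Finset.range N, c k + ∑ k ∈ Finset.range (N + 1), c k) / 2)
      atTop (𝓝 l)) :
    Tendsto (fun n : ℕ => (n : ℝ)⁻¹ * ∑ N ∈ Finset.range n, ∑ k ∈ Finset.range (N + 1), c k)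
      atTop (𝓝 l) := by
  -- Replacing partial sums by means of neighbours changes the Cesàro mean only by a boundary term,
  -- half the n-th partial sum over n.
  have h2 : Tendsto (fun n : ℕ => (n : ℝ)⁻¹ * (∑ k ∈ Finset.range n, c k)) atTop (𝓝 0) := by
    refine squeeze_zero_norm (a := fun n : ℕ => (n : ℝ)⁻¹ * (B + c 0)) (fun n => ?_) ?_
    · rw [norm_mul, Real.norm_of_nonneg (by positivity)]
      exact mul_le_mul_of_nonneg_left (hc.sum_range_le hB n) (by positivity)
    · simpa using (tendsto_inv_atTop_nhds_zero_nat (𝕜 := ℝ)).mul_const (B + c 0)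
  have h3 := hl.cesaro.add (h2.div_const 2)
  rw [zero_div, add_zero] at h3
  refine h3.congr fun n => ?_
  rw [mul_div_assoc, ← mul_add]
  congr 1
  induction n with
  | zero => simp
  | succ n ih =>
    rw [Finset.sum_range_succ _ n, Finset.sum_range_succ (fun N => ∑ k ∈ Finset.range (N + 1), c k) n,
      ← ih, Finset.sum_range_succ c n]
    ring

/-- In the unbounded case the Cesàro means of the partial sums diverge. -/
lemma tendsto_cesaro_atTop (hc : IsAutocovariance c)
    (hB : ¬ ∃ B, ∀ K, ∑ k ∈ Finset.range (2 * K), c k ≤ B) :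
    Tendsto (fun n : ℕ => (n : ℝ)⁻¹ * ∑ N ∈ Finset.range n, ∑ k ∈ Finset.range (N + 1), c k)
      atTop atTop := by
  push Not at hB
  have h1 : Tendsto (fun K => ∑ k ∈ Finset.range (2 * K), c k) atTop atTop :=
    tendsto_atTop_atTop_of_monotone hc.sum_range_even_mono fun b => (hB b).imp fun _ h => h.le
  have h2 : Tendsto (fun N => ∑ k ∈ Finset.range N, c k) atTop atTop := by
    refine tendsto_atTop_of_even_of_odd h1 (tendsto_atTop_mono (fun K => ?_) h1)
    rw [Finset.sum_range_succ]
    linarith [hc.even_nonneg K]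
  have h3 := h2.comp (tendsto_add_atTop_nat 1)
  refine tendsto_atTop.2 fun b => ?_
  -- Truncation at b + 1 gives a convergent sequence below the partial sums, so the finite Cesàro
  -- theorem applies.
  have h4 : Tendsto (fun N => min (∑ k ∈ Finset.range (N + 1), c k) (b + 1)) atTop (𝓝 (b + 1)) :=
    tendsto_const_nhds.congr' ((h3.eventually_ge_atTop (b + 1)).mono fun N hN =>
      (min_eq_right hN).symm)
  filter_upwards [h4.cesaro.eventually_const_lt (lt_add_one b)] with n hn
  refine hn.le.trans (mul_le_mul_of_nonneg_left ?_ (by positivity))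
  exact Finset.sum_le_sum fun N _ => min_le_left _ _

lemma summable_mul_pow (hc : IsAutocovariance c) {b : ℝ} (h0 : 0 ≤ b) (h1 : b < 1) :
    Summable fun k => c k * b ^ k := by
  refine Summable.of_norm_bounded ((summable_geometric_of_lt_one h0 h1).mul_left (c 0)) fun k => ?_
  rw [norm_mul, Real.norm_of_nonneg (pow_nonneg h0 k)]
  exact mul_le_mul_of_nonneg_right (hc.abs_le k) (pow_nonneg h0 k)

/-- In the bounded case the Abel means converge to the same limit. -/
lemma tendsto_abel (hc : IsAutocovariance c) {l : ℝ}
    (hl : Tendsto (fun N => (∑ k ∈ Finset.range N, c k + ∑ k ∈ Finset.range (N + 1), c k) / 2)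
      atTop (𝓝 l)) :
    Tendsto (fun b : ℝ => ∑' k, c k * b ^ k) (𝓝[<] 1) (𝓝 l) := by
  -- The partial sums of `d` are the means of neighbouring partial sums of `c`, and its power series
  -- is (1 + b)/2 times that of `c`. Abel's theorem for `d` thus gives the claim, as this factor
  -- tends to 1.
  let d : ℕ → ℝ := fun N => (c N + if N = 0 then 0 else c (N - 1)) / 2
  have hd : Tendsto (fun n => ∑ i ∈ Finset.range n, d i) atTop (𝓝 l) := by
    rw [← tendsto_add_atTop_iff_nat 1]
    refine hl.congr fun n => ?_
    induction n with
    | zero => simp [d]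
    | succ n ih =>
      rw [Finset.sum_range_succ d (n + 1), ← ih]
      simp only [Finset.sum_range_succ, d]
      simp
      ring
  have h := Real.tendsto_tsum_powerSeries_nhdsWithin_lt hd
  have h2 : Tendsto (fun b : ℝ => 2 / (1 + b)) (𝓝[<] 1) (𝓝 1) := by
    have : ContinuousAt (fun b : ℝ => 2 / (1 + b)) 1 :=
      continuousAt_const.div (by fun_prop) (by norm_num)
    have h := this.tendsto
    norm_num at h
    exact h.mono_left nhdsWithin_le_nhds
  have h3 := h2.mul h
  rw [one_mul] at h3
  refine h3.congr' ?_
  filter_upwards [self_mem_nhdsWithin, nhdsWithin_le_nhds (lt_mem_nhds one_pos)] with b hb1 hb0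
  replace hb1 : b < 1 := hb1
  have hs := hc.summable_mul_pow hb0.le hb1
  have hs' : HasSum (fun n => d n * b ^ n) ((∑' k, c k * b ^ k) * ((1 + b) / 2)) := by
    have e1 : HasSum (fun n => (if n = 0 then 0 else c (n - 1)) * b ^ n)
        (b * ∑' k, c k * b ^ k) := by
      rw [← hasSum_nat_add_iff' 1]
      simp only [Finset.sum_range_one, if_true, zero_mul, sub_zero]
      refine (hs.hasSum.mul_left b).congr_fun ?_
      intro n
      simp [pow_succ]
      ring
    have e2 := (hs.hasSum.add e1).div_const 2
    rw [show (∑' k, c k * b ^ k) * ((1 + b) / 2) =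
      (∑' k, c k * b ^ k + b * ∑' k, c k * b ^ k) / 2 by ring]
    exact e2.congr_fun fun n => by simp only [d]; ring
  rw [hs'.tsum_eq]
  have : 1 + b ≠ 0 := by positivity
  field_simp

/-- Bounded Abel means force bounded partial sums. -/
lemma sum_range_even_le_of_abel (hc : IsAutocovariance c) {B : ℝ}
    (hB : ∀ᶠ b : ℝ in 𝓝[<] 1, ∑' k, c k * b ^ k ≤ B) (K : ℕ) :
    ∑ k ∈ Finset.range (2 * K), c k ≤ B := by
  have hlim : Tendsto (fun b : ℝ => ∑ k ∈ Finset.range (2 * K), c k * b ^ k) (𝓝[<] 1)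
      (𝓝 (∑ k ∈ Finset.range (2 * K), c k)) := by
    have : Continuous fun b : ℝ => ∑ k ∈ Finset.range (2 * K), c k * b ^ k := by fun_prop
    simpa using (this.tendsto 1).mono_left nhdsWithin_le_nhds
  refine le_of_tendsto hlim ?_
  filter_upwards [hB, self_mem_nhdsWithin, nhdsWithin_le_nhds (lt_mem_nhds one_pos)]
    with b hb hb1 hb0
  replace hb1 : b < 1 := hb1
  have hs := hc.summable_mul_pow hb0.le hb1
  have hmono : Monotone fun K => ∑ k ∈ Finset.range (2 * K), c k * b ^ k := by
    refine monotone_nat_of_le_succ fun K => ?_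
    rw [mul_add, mul_one, Finset.sum_range_succ, Finset.sum_range_succ]
    -- The pair c_{2K} + b c_{2K+1} is a convex combination of c_{2K} + c_{2K+1} and c_{2K}, hence
    -- nonnegative.
    have h1 : 0 ≤ b ^ (2 * K) * (b * (c (2 * K) + c (2 * K + 1)) + (1 - b) * c (2 * K)) :=
      mul_nonneg (by positivity) (add_nonneg (mul_nonneg hb0.le (hc.pair_nonneg K))
        (mul_nonneg (by linarith) (hc.even_nonneg K)))
    rw [pow_succ]
    linarith
  have ht : Tendsto (fun K => ∑ k ∈ Finset.range (2 * K), c k * b ^ k) atTop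
      (𝓝 (∑' k, c k * b ^ k)) :=
    hs.hasSum.tendsto_sum_nat.comp (tendsto_id.const_mul_atTop' two_pos)
  exact (hmono.ge_of_tendsto ht K).trans hb

end IsAutocovariance

/-! ### Self-adjoint contractions -/

section Hilbert

variable {H : Type*} [NormedAddCommGroup H] [InnerProductSpace ℝ H]

open RealInnerProductSpace

lemma inner_pow_left_of_symm {P : H →L[ℝ] H} (hP : ∀ f g, ⟪P f, g⟫ = ⟪f, P g⟫) (k : ℕ) (f g : H) :
    ⟪(P ^ k) f, g⟫ = ⟪f, (P ^ k) g⟫ := by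
  induction k generalizing f g with
  | zero => simp
  | succ k ih =>
    rw [pow_succ, mul_apply_eq_comp, ih, hP, ← mul_apply_eq_comp, ← pow_succ', pow_succ]

lemma norm_pow_apply_le {P : H →L[ℝ] H} (h1 : ∀ f, ‖P f‖ ≤ ‖f‖) (k : ℕ) (f : H) :
    ‖(P ^ k) f‖ ≤ ‖f‖ := by
  induction k with
  | zero => simp
  | succ k ih =>
    rw [pow_succ', mul_apply_eq_comp]
    exact (h1 _).trans ih

lemma inner_pow_two_mul {P : H →L[ℝ] H} (hP : ∀ f g, ⟪P f, g⟫ = ⟪f, P g⟫) (k : ℕ) (f : H) :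
    ⟪f, (P ^ (2 * k)) f⟫ = ⟪(P ^ k) f, (P ^ k) f⟫ := by
  rw [inner_pow_left_of_symm hP, two_mul, pow_add, mul_apply_eq_comp]

lemma inner_pow_two_mul_add_one {P : H →L[ℝ] H} (hP : ∀ f g, ⟪P f, g⟫ = ⟪f, P g⟫) (k : ℕ) (f : H) :
    ⟪f, (P ^ (2 * k + 1)) f⟫ = ⟪(P ^ k) f, P ((P ^ k) f)⟫ := by
  rw [inner_pow_left_of_symm hP, ← mul_apply_eq_comp, ← mul_apply_eq_comp,
    mul_assoc, ← pow_succ', ← pow_add]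
  congr 3; ring

/-- With u = P^k f, self-adjointness turns the even terms into ‖u‖² and the odd ones into ⟨u, Pu⟩.
Contractivity and Cauchy–Schwarz give the rest. -/
lemma isAutocovariance_inner_pow {P : H →L[ℝ] H} (hP : ∀ f g, ⟪P f, g⟫ = ⟪f, P g⟫)
    (h1 : ∀ f, ‖P f‖ ≤ ‖f‖) (f : H) : IsAutocovariance fun k => ⟪f, (P ^ k) f⟫ where
  even_nonneg k := by
    rw [inner_pow_two_mul hP]; exact real_inner_self_nonneg
  even_anti k := by
    simp only [inner_pow_two_mul hP, real_inner_self_eq_norm_sq]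
    gcongr
    rw [pow_succ', mul_apply_eq_comp]
    exact h1 _
  pair_nonneg k := by
    rw [inner_pow_two_mul hP, inner_pow_two_mul_add_one hP]
    have h := (abs_le.1 (abs_real_inner_le_norm ((P ^ k) f) (P ((P ^ k) f)))).1
    rw [real_inner_self_eq_norm_sq]
    nlinarith [h1 ((P ^ k) f), norm_nonneg ((P ^ k) f)]
  abs_le k := by
    refine (abs_real_inner_le_norm _ _).trans ?_
    simp only [pow_zero, one_apply_eq_self, real_inner_self_eq_norm_mul_norm]
    gcongr
    exact norm_pow_apply_le h1 k f

/-- The Neumann series of (1 - bP)⁻¹. It identifies Abel means of autocovariances with pairings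
against the resolvent. -/
lemma exists_resolvent [CompleteSpace H] {P : H →L[ℝ] H} (h1 : ∀ f, ‖P f‖ ≤ ‖f‖) {b : ℝ}
    (hb0 : 0 ≤ b) (hb1 : b < 1) (f : H) :
    ∃ g, g - b • P g = f ∧ ∀ h, HasSum (fun k => ⟪h, (P ^ k) f⟫ * b ^ k) ⟪h, g⟫ := by
  have hs : Summable fun k => b ^ k • (P ^ k) f := by
    refine Summable.of_norm_bounded ((summable_geometric_of_lt_one hb0 hb1).mul_right ‖f‖)
      fun k => ?_
    rw [norm_smul, Real.norm_of_nonneg (pow_nonneg hb0 k)]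
    exact mul_le_mul_of_nonneg_left (norm_pow_apply_le h1 k f) (pow_nonneg hb0 k)
  refine ⟨∑' k, b ^ k • (P ^ k) f, ?_, fun h => ?_⟩
  · have h2 := hs.tsum_eq_zero_add
    have h3 : b • P (∑' k, b ^ k • (P ^ k) f) = ∑' k, b ^ (k + 1) • (P ^ (k + 1)) f := by
      rw [P.map_tsum hs, ← tsum_const_smul'' b]
      refine tsum_congr fun k => ?_
      rw [map_smul, smul_smul, ← pow_succ', pow_succ' P, mul_apply_eq_comp]
    rw [h3]
    nth_rewrite 1 [h2]
    simp
  · have h4 := (innerSL ℝ h).hasSum hs.hasSum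
    refine h4.congr_fun fun k => ?_
    simp [mul_comm]

/-- Comparison of Abel means of autocovariances: if every `g` has a counterpart `g'` with the same
pairing and, up to the factor `κ`, a smaller energy, then the Abel means are ordered. -/
lemma abel_le_of_energy_le {H' : Type*} [NormedAddCommGroup H'] [InnerProductSpace ℝ H']
    [CompleteSpace H] [CompleteSpace H'] {P : H →L[ℝ] H} {P' : H' →L[ℝ] H'}
    (h1 : ∀ f, ‖P f‖ ≤ ‖f‖)
    (hP' : ∀ f g, ⟪P' f, g⟫ = ⟪f, P' g⟫) (h1' : ∀ f, ‖P' f‖ ≤ ‖f‖)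
    {f : H} {f' : H'} {κ b : ℝ} (hκ : 0 < κ) (hb0 : 0 ≤ b) (hb1 : b < 1)
    (hJ : ∀ g : H, ∃ g' : H', ⟪f', g'⟫ = ⟪f, g⟫ ∧
      ⟪g', g' - b • P' g'⟫ ≤ κ * ⟪g, g - b • P g⟫) :
    ∑' k, ⟪f, (P ^ k) f⟫ * b ^ k ≤ κ * ∑' k, ⟪f', (P' ^ k) f'⟫ * b ^ k := by
  obtain ⟨g, hg, hgs⟩ := exists_resolvent h1 hb0 hb1 f
  obtain ⟨h, hh, hhs⟩ := exists_resolvent h1' hb0 hb1 f'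
  obtain ⟨g', e1, e2⟩ := hJ g
  rw [(hgs f).tsum_eq, (hhs f').tsum_eq]
  rw [hg, real_inner_comm f g] at e2
  -- With g and h the two resolvents, expanding the nonnegative energy of g' - κh gives 0 ≤ κ⟨f, g⟩
  -- - 2κ⟨f, g⟩ + κ²⟨f', h⟩. The multiple κ of h is the one for which this is the claim.
  have hpos : 0 ≤ ⟪g' - κ • h, (g' - κ • h) - b • P' (g' - κ • h)⟫ := by
    rw [inner_sub_right, real_inner_self_eq_norm_mul_norm, real_inner_smul_right]
    have h3 := real_inner_le_norm (g' - κ • h) (P' (g' - κ • h))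
    have h4 := h1' (g' - κ • h)
    have h5 := norm_nonneg (g' - κ • h)
    nlinarith [mul_le_mul_of_nonneg_left h4 h5, mul_nonneg h5 h5,
      mul_le_mul_of_nonneg_left (h3.trans (mul_le_mul_of_nonneg_left h4 h5)) hb0]
  have e3 : ⟪g' - κ • h, (g' - κ • h) - b • P' (g' - κ • h)⟫ =
      ⟪g', g' - b • P' g'⟫ - 2 * κ * ⟪g', h - b • P' h⟫ + κ ^ 2 * ⟪h, h - b • P' h⟫ := by
    have e4 : ⟪h, P' g'⟫ = ⟪g', P' h⟫ := by rw [← hP', real_inner_comm]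
    have e5 : ⟪h, g'⟫ = ⟪g', h⟫ := real_inner_comm _ _
    simp only [map_sub, map_smul, inner_sub_left, inner_sub_right, real_inner_smul_left,
      real_inner_smul_right, smul_sub, e4, e5]
    ring
  rw [e3, hh, real_inner_comm f' g', e1, real_inner_comm f' h] at hpos
  refine le_of_mul_le_mul_left ?_ hκ
  nlinarith

end Hilbert

/-! ### Sums of stationary sequences -/

/-- The second moment of a sum of random variables whose covariances depend on the lag only. -/
lemma integral_sum_sq_of_stationary {Ω : Type*} [MeasurableSpace Ω] {ρ : Measure Ω}
    {Y : ℕ → Ω → ℝ} {c : ℕ → ℝ} (hint : ∀ i j, Integrable (fun ω => Y i ω * Y j ω) ρ)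
    (hc : ∀ j k, ∫ ω, Y j ω * Y (j + k) ω ∂ρ = c k) (n : ℕ) :
    ∫ ω, (∑ k ∈ Finset.Icc 1 n, Y k ω) ^ 2 ∂ρ =
      2 * ∑ N ∈ Finset.range n, ∑ k ∈ Finset.range (N + 1), c k - n * c 0 := by
  have hint' (n j : ℕ) : Integrable (fun ω => (∑ k ∈ Finset.Icc 1 n, Y k ω) * Y j ω) ρ := by
    simp only [Finset.sum_mul]
    exact integrable_finsetSum _ fun k _ => hint k j
  have hcov (n : ℕ) : ∫ ω, (∑ k ∈ Finset.Icc 1 n, Y k ω) * Y (n + 1) ω ∂ρ =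
      ∑ k ∈ Finset.range n, c (k + 1) := by
    simp only [Finset.sum_mul]
    rw [integral_finsetSum _ fun k _ => hint k (n + 1), ← Finset.sum_range_reflect,
      show Finset.Icc 1 n = Finset.Ico (0 + 1) (n + 1) by ext; simp,
      ← Finset.sum_Ico_add' _ 0 n 1, ← Finset.range_eq_Ico]
    refine Finset.sum_congr rfl fun k hk => ?_
    rw [Finset.mem_range] at hk
    rw [← hc (k + 1), show k + 1 + (n - 1 - k + 1) = n + 1 by omega]
  induction n with
  | zero => simp
  | succ n ih =>
    have e : ∀ ω, (∑ k ∈ Finset.Icc 1 (n + 1), Y k ω) ^ 2 =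
        (∑ k ∈ Finset.Icc 1 n, Y k ω) ^ 2 +
          2 * ((∑ k ∈ Finset.Icc 1 n, Y k ω) * Y (n + 1) ω) + Y (n + 1) ω * Y (n + 1) ω :=
      fun ω => by rw [Finset.sum_Icc_succ_top (by omega)]; ring
    have hsq : Integrable (fun ω => (∑ k ∈ Finset.Icc 1 n, Y k ω) ^ 2) ρ := by
      simp only [sq, Finset.mul_sum]
      exact integrable_finsetSum _ fun k _ => hint' n k
    have hd := (hint' n (n + 1)).const_mul 2
    have h0 := hc (n + 1) 0
    rw [add_zero] at h0
    simp only [e]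
    rw [integral_add (f := fun ω => (∑ k ∈ Finset.Icc 1 n, Y k ω) ^ 2 +
        2 * ((∑ k ∈ Finset.Icc 1 n, Y k ω) * Y (n + 1) ω)) (hsq.add hd) (hint _ _),
      integral_add hsq hd, integral_const_mul, ih, hcov, h0, Finset.sum_range_succ _ n,
      Finset.sum_range_succ' _ n]
    push_cast
    ring

/-- The variance of a normalised sum of random variables with a common mean whose covariances
depend on the lag only. -/
lemma evariance_sum_of_stationary {Ω : Type*} [MeasurableSpace Ω] {ρ : Measure Ω}
    [IsProbabilityMeasure ρ] {Y : ℕ → Ω → ℝ} {c : ℕ → ℝ} {a : ℝ} (hY : ∀ k, MemLp (Y k) 2 ρ)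
    (ha : ∀ k, ∫ ω, Y k ω ∂ρ = a)
    (hc : ∀ j k, ∫ ω, (Y j ω - a) * (Y (j + k) ω - a) ∂ρ = c k) {n : ℕ} (hn : n ≠ 0) :
    evariance (fun ω => (√(n : ℝ))⁻¹ * ∑ k ∈ Finset.Icc 1 n, Y k ω) ρ =
      ENNReal.ofReal (2 * ((n : ℝ)⁻¹ * ∑ N ∈ Finset.range n, ∑ k ∈ Finset.range (N + 1), c k)
        - c 0) := by
  have hmean : ∫ ω, ∑ k ∈ Finset.Icc 1 n, Y k ω ∂ρ = n * a := by
    rw [integral_finsetSum _ fun k _ => (hY k).integrable one_le_two]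
    simp [ha]
  have hY' (k : ℕ) : MemLp (fun ω => Y k ω - a) 2 ρ := (hY k).sub (memLp_const a)
  have hsum (ω : Ω) : ∑ k ∈ Finset.Icc 1 n, Y k ω - n * a = ∑ k ∈ Finset.Icc 1 n, (Y k ω - a) := by
    simp [Finset.sum_sub_distrib]
  have hn' : (n : ℝ) ≠ 0 := by exact_mod_cast hn
  have hsq : Integrable (fun ω => (∑ k ∈ Finset.Icc 1 n, (Y k ω - a)) ^ 2) ρ :=
    (memLp_finsetSum _ fun k _ => hY' k).integrable_sq
  rw [evariance_mul, evariance_eq_lintegral_ofReal, hmean]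
  simp only [hsum]
  rw [← ofReal_integral_eq_lintegral_ofReal hsq (Eventually.of_forall fun _ => sq_nonneg _),
    integral_sum_sq_of_stationary (fun i j => (hY' i).integrable_mul (hY' j)) hc,
    ← ENNReal.ofReal_mul (sq_nonneg _), inv_pow, Real.sq_sqrt (Nat.cast_nonneg n)]
  congr 1
  field_simp

/-! ### The operator on `L²` of a reversible kernel -/

section ReversibleKernel

variable {S : Type*} [MeasurableSpace S] {μ : Measure S} [IsProbabilityMeasure μ]
  {P : Kernel S S} [IsMarkovKernel P]

open RealInnerProductSpace

lemma measurePreserving_fst_compProd : MeasurePreserving Prod.fst (μ ⊗ₘ P) μ :=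
  ⟨measurable_fst, by rw [← Measure.fst, Measure.fst_compProd]⟩

lemma measurePreserving_snd_compProd (hrev : MeasurePreserving Prod.swap (μ ⊗ₘ P) (μ ⊗ₘ P)) :
    MeasurePreserving Prod.snd (μ ⊗ₘ P) μ :=
  measurePreserving_fst_compProd.comp hrev

/-- The operator `g ↦ ∫ g(z') P(·, dz')` on `L²(μ)`, for a `μ`-reversible kernel `P`. -/
noncomputable def kernelOp (hrev : MeasurePreserving Prod.swap (μ ⊗ₘ P) (μ ⊗ₘ P)) :
    Lp ℝ 2 μ →L[ℝ] Lp ℝ 2 μ :=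
  (ContinuousLinearMap.adjoint (Lp.compMeasurePreservingₗᵢ (E := ℝ) (p := 2) ℝ Prod.fst
    (measurePreserving_fst_compProd (μ := μ) (P := P))).toContinuousLinearMap) ∘L
  (Lp.compMeasurePreservingₗᵢ ℝ Prod.snd
    (measurePreserving_snd_compProd hrev)).toContinuousLinearMap

variable (hrev : MeasurePreserving Prod.swap (μ ⊗ₘ P) (μ ⊗ₘ P))

omit [IsProbabilityMeasure μ] in
lemma integrable_mul_comp {Ω : Type*} [MeasurableSpace Ω] {ρ : Measure Ω} {u v : Ω → S}
    (hu : MeasurePreserving u ρ μ) (hv : MeasurePreserving v ρ μ) {f g : S → ℝ}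
    (hf : MemLp f 2 μ) (hg : MemLp g 2 μ) : Integrable (fun ω => f (u ω) * g (v ω)) ρ :=
  (hf.comp_measurePreserving hu).integrable_mul (hg.comp_measurePreserving hv)

omit [IsProbabilityMeasure μ] in
lemma integral_comp_measurePreserving {Ω : Type*} [MeasurableSpace Ω] {ρ : Measure Ω} {u : Ω → S}
    (hu : MeasurePreserving u ρ μ) {f : S → ℝ} (hf : AEStronglyMeasurable f μ) :
    ∫ ω, f (u ω) ∂ρ = ∫ z, f z ∂μ := by
  have h := integral_map hu.measurable.aemeasurable (hu.map_eq.symm ▸ hf)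
  rw [hu.map_eq] at h
  exact h.symm

lemma inner_eq_integral_mul {Ω : Type*} [MeasurableSpace Ω] {ρ : Measure Ω} (f g : Lp ℝ 2 ρ) :
    ⟪f, g⟫ = ∫ ω, f ω * g ω ∂ρ := by
  rw [L2.inner_def]
  simp [mul_comm]

/-- The operator is pullback along the second coordinate followed by the adjoint of pullback along
the first, so pairings are integrals over the joint law of one transition. Self-adjointness then
becomes swap invariance. -/
lemma inner_kernelOp (f g : Lp ℝ 2 μ) :
    ⟪f, kernelOp hrev g⟫ = ∫ p, f p.1 * g p.2 ∂(μ ⊗ₘ P) := by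
  rw [kernelOp, ContinuousLinearMap.comp_apply, ContinuousLinearMap.adjoint_inner_right,
    inner_eq_integral_mul]
  refine integral_congr_ae ?_
  filter_upwards [Lp.coeFn_compMeasurePreserving f (measurePreserving_fst_compProd (P := P)),
    Lp.coeFn_compMeasurePreserving g (measurePreserving_snd_compProd hrev)] with p h1 h2
  exact congrArg₂ (· * ·) h1 h2

lemma inner_kernelOp_left (f g : Lp ℝ 2 μ) : ⟪kernelOp hrev f, g⟫ = ⟪f, kernelOp hrev g⟫ := by
  rw [real_inner_comm, inner_kernelOp, inner_kernelOp, ← MeasurePreserving.integral_comp'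
    (f := MeasurableEquiv.prodComm) hrev]
  exact integral_congr_ae (Eventually.of_forall fun p => mul_comm _ _)

lemma norm_kernelOp_le (f : Lp ℝ 2 μ) : ‖kernelOp hrev f‖ ≤ ‖f‖ := by
  rw [kernelOp, ContinuousLinearMap.comp_apply]
  refine (ContinuousLinearMap.le_opNorm _ _).trans ?_
  rw [LinearIsometryEquiv.norm_map]
  have h1 := (Lp.compMeasurePreservingₗᵢ (E := ℝ) (p := 2) ℝ Prod.fst
    (measurePreserving_fst_compProd (μ := μ) (P := P))).norm_toContinuousLinearMap_le
  have h2 : ‖(Lp.compMeasurePreservingₗᵢ ℝ Prod.snd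
    (measurePreserving_snd_compProd hrev)).toContinuousLinearMap f‖ = ‖f‖ :=
    LinearIsometry.norm_map _ f
  rw [h2]
  exact mul_le_of_le_one_left (norm_nonneg _) h1

/-- Testing against indicators identifies the abstract adjoint with integration against the kernel.
This is what links the operator to the chain and to `IsPositiveKernel`. -/
lemma kernelOp_ae_eq (g : Lp ℝ 2 μ) : kernelOp hrev g =ᵐ[μ] fun z => ∫ z', g z' ∂(P z) := by
  have hg : Integrable (fun p : S × S => g p.2) (μ ⊗ₘ P) :=
    ((Lp.memLp g).comp_measurePreserving (measurePreserving_snd_compProd hrev)).integrable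
      one_le_two
  refine Integrable.ae_eq_of_forall_setIntegral_eq _ _ ((Lp.memLp _).integrable one_le_two)
    hg.integral_compProd fun s hs _ => ?_
  have h1 := inner_kernelOp hrev (indicatorConstLp 2 hs (measure_ne_top μ s) (1 : ℝ)) g
  rw [L2.inner_indicatorConstLp_one] at h1
  rw [h1]
  have h2 : (fun p : S × S => (indicatorConstLp 2 hs (measure_ne_top μ s) (1 : ℝ)) p.1 * g p.2)
      =ᵐ[μ ⊗ₘ P] (Prod.fst ⁻¹' s).indicator fun p => g p.2 := by
    filter_upwards [measurePreserving_fst_compProd.quasiMeasurePreserving.ae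
      (indicatorConstLp_coeFn (p := 2) (hs := hs) (hμs := measure_ne_top μ s) (c := (1 : ℝ)))]
      with p hp
    rw [hp]
    by_cases h : p.1 ∈ s <;> simp [h]
  rw [integral_congr_ae h2, Measure.integral_compProd (hg.indicator (measurable_fst hs)),
    ← integral_indicator hs]
  refine integral_congr_ae (Eventually.of_forall fun z => ?_)
  by_cases h : z ∈ s <;> simp [Set.indicator, h]

/-! ### Moments of the stationary chain -/

omit [IsProbabilityMeasure μ] in
lemma measurePreserving_chainLaw_zero :
    MeasurePreserving (fun z : ℕ → S => z 0) (chainLaw μ P) μ := by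
  refine ⟨measurable_pi_apply 0, ?_⟩
  have h : (fun z : ℕ → S => z 0) =
      (fun h : (∀ _ : Finset.Iic 0, S) => h ⟨0, Finset.mem_Iic.2 le_rfl⟩) ∘
        Preorder.frestrictLe (π := fun _ => S) 0 := rfl
  rw [h, ← Measure.map_map (by fun_prop) (by fun_prop), chainLaw, Kernel.trajMeasure,
    Measure.map_comp _ _ (by fun_prop), Kernel.traj_map_frestrictLe, Kernel.partialTraj_self,
    Measure.id_comp, Measure.map_map (by fun_prop) (by fun_prop)]
  exact Measure.map_id

instance : IsProbabilityMeasure (chainLaw μ P) := by unfold chainLaw; infer_instance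

/-- The Markov property: the conditional law of `Z_{n+1}` given `Z_0, …, Z_n` is `P (Z_n)`. -/
lemma lintegral_chainLaw_succ (n : ℕ) {F : (Finset.Iic n → S) × S → ℝ≥0∞} (hF : Measurable F) :
    ∫⁻ z, F (fun i => z i, z (n + 1)) ∂(chainLaw μ P) =
      ∫⁻ z, ∫⁻ y, F (fun i => z i, y) ∂(P (z n)) ∂(chainLaw μ P) := by
  have h := Kernel.map_frestrictLe_trajMeasure_compProd_eq_map_trajMeasure (X := fun _ => S)
    (μ₀ := μ) (κ := fun n => P.comap (fun h : (∀ _ : Finset.Iic n, S) =>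
      h ⟨n, Finset.mem_Iic.2 le_rfl⟩) (measurable_pi_apply _)) (a := n)
  have h1 := congrArg (fun ρ => ∫⁻ p, F p ∂ρ) h
  rw [Measure.lintegral_compProd hF, lintegral_map hF (by fun_prop),
    lintegral_map (hF.lintegral_kernel_prod_right' (κ := P.comap _ _)) (by fun_prop)] at h1
  exact h1.symm

/-- The joint law of `(Z_j, Z_n, Z_{n+1})`, for `j ≤ n`. -/
lemma map_chainLaw_succ {j n : ℕ} (hj : j ≤ n) :
    (chainLaw μ P).map (fun z => ((z j, z n), z (n + 1))) =
      (chainLaw μ P).map (fun z => (z j, z n)) ⊗ₘ P.comap Prod.snd measurable_snd := by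
  refine Measure.ext_of_lintegral _ fun F hF => ?_
  rw [lintegral_map hF (by fun_prop), Measure.lintegral_compProd hF,
    lintegral_map hF.lintegral_kernel_prod_right' (by fun_prop)]
  exact lintegral_chainLaw_succ (μ := μ) (P := P) n (F := fun p => F ((p.1 ⟨j, Finset.mem_Iic.2 hj⟩,
    p.1 ⟨n, Finset.mem_Iic.2 le_rfl⟩), p.2)) (hF.comp (by fun_prop))

include hrev in
lemma measurePreserving_chainLaw (n : ℕ) :
    MeasurePreserving (fun z : ℕ → S => z n) (chainLaw μ P) μ := by
  induction n with
  | zero => exact measurePreserving_chainLaw_zero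
  | succ n ih =>
    refine ⟨measurable_pi_apply _, ?_⟩
    refine Measure.ext_of_lintegral _ fun F hF => ?_
    rw [lintegral_map hF (by fun_prop), ← (measurePreserving_snd_compProd hrev).lintegral_comp hF,
      Measure.lintegral_compProd (f := fun p => F p.2) (by fun_prop),
      ← ih.lintegral_comp (Measurable.lintegral_kernel_prod_right' (f := fun p => F p.2)
        (by fun_prop))]
    exact lintegral_chainLaw_succ (μ := μ) (P := P) n (F := fun p => F p.2) (hF.comp (by fun_prop))

/-- Conditioning on the state at time j + k replaces g at the next time by Pg at that time, so
powers of the operator accumulate on g. -/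
lemma integral_chainLaw_mul (j k : ℕ) (f g : Lp ℝ 2 μ) :
    ∫ z, f (z j) * g (z (j + k)) ∂(chainLaw μ P) = ⟪f, (kernelOp hrev ^ k) g⟫ := by
  induction k generalizing g with
  | zero =>
    rw [pow_zero, one_apply_eq_self, inner_eq_integral_mul]
    exact integral_comp_measurePreserving (measurePreserving_chainLaw hrev j)
      ((Lp.aestronglyMeasurable f).mul (Lp.aestronglyMeasurable g))
  | succ k ih =>
    rw [pow_succ, mul_apply_eq_comp, ← ih]
    have hint := integrable_mul_comp (measurePreserving_chainLaw hrev j)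
      (measurePreserving_chainLaw hrev (j + k + 1)) (Lp.memLp f) (Lp.memLp g)
    have hF : StronglyMeasurable fun p : (S × S) × S => f p.1.1 * g p.2 :=
      ((Lp.stronglyMeasurable f).comp_measurable (by fun_prop)).mul
        ((Lp.stronglyMeasurable g).comp_measurable (by fun_prop))
    have hm : Measurable fun z : ℕ → S => ((z j, z (j + k)), z (j + k + 1)) := by fun_prop
    have e1 : ∫ z, f (z j) * g (z (j + (k + 1))) ∂(chainLaw μ P) =
        ∫ p, f p.1.1 * g p.2 ∂((chainLaw μ P).map
          fun z => ((z j, z (j + k)), z (j + k + 1))) := by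
      rw [integral_map hm.aemeasurable hF.aestronglyMeasurable]; rfl
    have hint' : Integrable (fun p : (S × S) × S => f p.1.1 * g p.2) ((chainLaw μ P).map
          fun z => ((z j, z (j + k)), z (j + k + 1))) := by
      rw [integrable_map_measure hF.aestronglyMeasurable hm.aemeasurable]; exact hint
    rw [e1]
    rw [map_chainLaw_succ (Nat.le_add_right j k)] at hint' ⊢
    rw [Measure.integral_compProd hint', integral_map (by fun_prop)
      hF.integral_kernel_prod_right'.aestronglyMeasurable]
    refine integral_congr_ae ?_
    filter_upwards [(measurePreserving_chainLaw hrev (j + k)).quasiMeasurePreserving.ae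
      (kernelOp_ae_eq hrev g)] with z hz
    rw [hz, ← integral_const_mul]
    rfl

/-- The class in `L²(μ)` of `f - ∫ f ∂μ`. -/
noncomputable def centredLp {f : S → ℝ} (hf : MemLp f 2 μ) : Lp ℝ 2 μ :=
  (hf.sub (memLp_const (∫ z, f z ∂μ))).toLp _

lemma centredLp_ae_eq {f : S → ℝ} (hf : MemLp f 2 μ) :
    centredLp hf =ᵐ[μ] fun z => f z - ∫ z, f z ∂μ :=
  MemLp.coeFn_toLp _

lemma evariance_chainLaw {f : S → ℝ} (hf : MemLp f 2 μ) {n : ℕ} (hn : n ≠ 0) :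
    evariance (fun z : ℕ → S => (√(n : ℝ))⁻¹ * ∑ k ∈ Finset.Icc 1 n, f (z k)) (chainLaw μ P) =
      ENNReal.ofReal (2 * ((n : ℝ)⁻¹ * ∑ N ∈ Finset.range n, ∑ k ∈ Finset.range (N + 1),
        ⟪centredLp hf, (kernelOp hrev ^ k) (centredLp hf)⟫)
          - ⟪centredLp hf, (kernelOp hrev ^ 0) (centredLp hf)⟫) := by
  have hp := measurePreserving_chainLaw (P := P) hrev
  refine evariance_sum_of_stationary (a := ∫ z, f z ∂μ)
    (c := fun k => ⟪centredLp hf, (kernelOp hrev ^ k) (centredLp hf)⟫)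
    (fun k => hf.comp_measurePreserving (hp k))
    (fun k => integral_comp_measurePreserving (hp k) hf.aestronglyMeasurable)
    (fun j k => ?_) hn
  rw [← integral_chainLaw_mul hrev j k]
  refine integral_congr_ae ?_
  filter_upwards [(hp j).quasiMeasurePreserving.ae (centredLp_ae_eq hf),
    (hp (j + k)).quasiMeasurePreserving.ae (centredLp_ae_eq hf)] with z h1 h2
  rw [h1, h2]
  rfl

end ReversibleKernel

/-! ### Asymptotic variances of reversible chains and their comparison -/

section Comparison

variable {S : Type*} [MeasurableSpace S] {μ : Measure S} [IsProbabilityMeasure μ]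
  {P : Kernel S S} [IsMarkovKernel P] (hrev : MeasurePreserving Prod.swap (μ ⊗ₘ P) (μ ⊗ₘ P))

open RealInnerProductSpace

/-- The lag-`k` autocovariance of `f` along the stationary reversible chain. -/
noncomputable def autocov {f : S → ℝ} (hf : MemLp f 2 μ) (k : ℕ) : ℝ :=
  ⟪centredLp hf, (kernelOp hrev ^ k) (centredLp hf)⟫

lemma isAutocovariance_autocov {f : S → ℝ} (hf : MemLp f 2 μ) :
    IsAutocovariance (autocov hrev hf) :=
  isAutocovariance_inner_pow (inner_kernelOp_left hrev) (norm_kernelOp_le hrev) _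

lemma isAsymptoticVariance_ofReal {f : S → ℝ} (hf : MemLp f 2 μ) {B l : ℝ}
    (hB : ∀ K, ∑ k ∈ Finset.range (2 * K), autocov hrev hf k ≤ B)
    (hl : Tendsto (fun N => (∑ k ∈ Finset.range N, autocov hrev hf k +
      ∑ k ∈ Finset.range (N + 1), autocov hrev hf k) / 2) atTop (𝓝 l)) :
    IsAsymptoticVariance μ P f (ENNReal.ofReal (2 * l - autocov hrev hf 0)) := by
  have h := (((isAutocovariance_autocov hrev hf).tendsto_cesaro hB hl).const_mul 2).sub_const
    (autocov hrev hf 0)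
  refine (ENNReal.tendsto_ofReal h).congr' ?_
  filter_upwards [eventually_ne_atTop 0] with n hn
  exact (evariance_chainLaw hrev hf hn).symm

lemma isAsymptoticVariance_top {f : S → ℝ} (hf : MemLp f 2 μ)
    (hB : ¬ ∃ B, ∀ K, ∑ k ∈ Finset.range (2 * K), autocov hrev hf k ≤ B) :
    IsAsymptoticVariance μ P f ∞ := by
  have h := tendsto_atTop_add_const_right _ (-autocov hrev hf 0)
    (((isAutocovariance_autocov hrev hf).tendsto_cesaro_atTop hB).const_mul_atTop two_pos)
  refine (ENNReal.tendsto_ofReal_nhds_top.2 h).congr' ?_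
  filter_upwards [eventually_ne_atTop 0] with n hn
  exact (evariance_chainLaw hrev hf hn).symm

include hrev in
/-- The asymptotic variance of a square integrable function along a stationary reversible chain
exists in `[0, ∞]`. -/
lemma exists_isAsymptoticVariance {f : S → ℝ} (hf : MemLp f 2 μ) :
    ∃ v, IsAsymptoticVariance μ P f v := by
  by_cases hB : ∃ B, ∀ K, ∑ k ∈ Finset.range (2 * K), autocov hrev hf k ≤ B
  · obtain ⟨B, hB⟩ := hB
    obtain ⟨l, hl⟩ := (isAutocovariance_autocov hrev hf).exists_tendsto_mean_sum hB
    exact ⟨_, isAsymptoticVariance_ofReal hrev hf hB hl⟩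
  · exact ⟨_, isAsymptoticVariance_top hrev hf hB⟩

lemma inner_kernelOp_nonneg (hpos : IsPositiveKernel μ P) (g : Lp ℝ 2 μ) :
    0 ≤ ⟪g, kernelOp hrev g⟫ := by
  rw [inner_eq_integral_mul]
  refine (hpos g (Lp.memLp g)).trans_eq (integral_congr_ae ?_)
  filter_upwards [kernelOp_ae_eq hrev g] with z hz
  rw [hz]

lemma autocov_nonneg (hpos : IsPositiveKernel μ P) {f : S → ℝ} (hf : MemLp f 2 μ) (k : ℕ) :
    0 ≤ autocov hrev hf k := by
  rcases Nat.even_or_odd' k with ⟨k, rfl | rfl⟩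
  · exact (isAutocovariance_autocov hrev hf).even_nonneg k
  · rw [autocov, inner_pow_two_mul_add_one (inner_kernelOp_left hrev)]
    exact inner_kernelOp_nonneg hrev hpos _

omit [IsProbabilityMeasure μ] in
lemma integral_mul_congr_ae {f₁ f₂ g₁ g₂ : S → ℝ} (hf : f₁ =ᵐ[μ] f₂) (hg : g₁ =ᵐ[μ] g₂) :
    ∫ z, f₁ z * g₁ z ∂μ = ∫ z, f₂ z * g₂ z ∂μ :=
  integral_congr_ae (hf.mul hg)

/-- The Dirichlet form of a reversible kernel. -/
lemma integral_sub_sq (g : Lp ℝ 2 μ) :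
    ∫ p, (g p.1 - g p.2) ^ 2 ∂(μ ⊗ₘ P) = 2 * ⟪g, g⟫ - 2 * ⟪g, kernelOp hrev g⟫ := by
  have h1 := measurePreserving_fst_compProd (μ := μ) (P := P)
  have h2 := measurePreserving_snd_compProd hrev
  have i11 := integrable_mul_comp h1 h1 (Lp.memLp g) (Lp.memLp g)
  have i12 := integrable_mul_comp h1 h2 (Lp.memLp g) (Lp.memLp g)
  have i22 := integrable_mul_comp h2 h2 (Lp.memLp g) (Lp.memLp g)
  have hm : AEStronglyMeasurable (fun z => g z * g z) μ :=
    (Lp.aestronglyMeasurable g).mul (Lp.aestronglyMeasurable g)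
  have e : ∀ p : S × S, (g p.1 - g p.2) ^ 2 = g p.1 * g p.1 + g p.2 * g p.2 - 2 * (g p.1 * g p.2) :=
    fun p => by ring
  simp only [e]
  rw [integral_sub (f := fun p : S × S => g p.1 * g p.1 + g p.2 * g p.2) (i11.add i22)
      (i12.const_mul 2), integral_add i11 i22, integral_const_mul,
    integral_comp_measurePreserving h1 hm, integral_comp_measurePreserving h2 hm,
    inner_kernelOp hrev, inner_eq_integral_mul]
  ring

lemma inner_sub_smul_kernelOp (g : Lp ℝ 2 μ) (b : ℝ) :
    ⟪g, g - b • kernelOp hrev g⟫ =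
      (1 - b) * ∫ z, g z ^ 2 ∂μ + b / 2 * ∫ p, (g p.1 - g p.2) ^ 2 ∂(μ ⊗ₘ P) := by
  rw [integral_sub_sq hrev, inner_sub_right, real_inner_smul_right, inner_eq_integral_mul g g]
  simp only [sq]
  ring

variable {S' : Type*} [MeasurableSpace S'] {μ' : Measure S'} [IsProbabilityMeasure μ']
  {P' : Kernel S' S'} [IsMarkovKernel P']
  (hrev' : MeasurePreserving Prod.swap (μ' ⊗ₘ P') (μ' ⊗ₘ P'))

include hrev hrev' in
/-- Comparison of asymptotic variances of two reversible chains, the second of which is positive,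
through a comparison of `L²` norms and Dirichlet forms. -/
theorem exists_isAsymptoticVariance_le {f : S → ℝ} {f' : S' → ℝ} (hf : MemLp f 2 μ)
    (hf' : MemLp f' 2 μ') {κ : ℝ} (hκ : 1 ≤ κ) (hpos : IsPositiveKernel μ' P')
    (hnorm : ∫ z, (f z - ∫ y, f y ∂μ) ^ 2 ∂μ = ∫ z, (f' z - ∫ y, f' y ∂μ') ^ 2 ∂μ')
    (hJ : ∀ g : S → ℝ, Measurable g → MemLp g 2 μ → ∃ g' : S' → ℝ, MemLp g' 2 μ' ∧
      ∫ z, (f' z - ∫ y, f' y ∂μ') * g' z ∂μ' = ∫ z, (f z - ∫ y, f y ∂μ) * g z ∂μ ∧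
      ∫ z, g' z ^ 2 ∂μ' ≤ κ * ∫ z, g z ^ 2 ∂μ ∧
      ∫ p, (g' p.1 - g' p.2) ^ 2 ∂(μ' ⊗ₘ P') ≤ κ * ∫ p, (g p.1 - g p.2) ^ 2 ∂(μ ⊗ₘ P)) :
    ∃ v v' : ℝ≥0∞, IsAsymptoticVariance μ P f v ∧ IsAsymptoticVariance μ' P' f' v' ∧
      v ≤ ENNReal.ofReal (2 * κ - 1) * v' := by
  have hc := isAutocovariance_autocov hrev hf
  have hc' := isAutocovariance_autocov hrev' hf'
  by_cases hB' : ∃ B, ∀ K, ∑ k ∈ Finset.range (2 * K), autocov hrev' hf' k ≤ B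
  swap
  · obtain ⟨v, hv⟩ := exists_isAsymptoticVariance hrev hf
    refine ⟨v, ∞, hv, isAsymptoticVariance_top hrev' hf' hB', ?_⟩
    rw [ENNReal.mul_top (by rw [Ne, ENNReal.ofReal_eq_zero]; linarith)]
    exact le_top
  obtain ⟨B', hB'⟩ := hB'
  obtain ⟨l', hl'⟩ := hc'.exists_tendsto_mean_sum hB'
  have habel' := hc'.tendsto_abel hl'
  have h0 : autocov hrev hf 0 = autocov hrev' hf' 0 := by
    simp only [autocov, pow_zero, one_apply_eq_self, inner_eq_integral_mul]
    rw [integral_mul_congr_ae (centredLp_ae_eq hf) (centredLp_ae_eq hf),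
      integral_mul_congr_ae (centredLp_ae_eq hf') (centredLp_ae_eq hf')]
    simpa only [sq] using hnorm
  have hle : ∀ᶠ b : ℝ in 𝓝[<] 1, ∑' k, autocov hrev hf k * b ^ k ≤
      κ * ∑' k, autocov hrev' hf' k * b ^ k := by
    filter_upwards [self_mem_nhdsWithin, nhdsWithin_le_nhds (lt_mem_nhds one_pos)] with b hb1 hb0
    replace hb1 : b < 1 := hb1
    refine abel_le_of_energy_le (norm_kernelOp_le hrev) (inner_kernelOp_left hrev')
      (norm_kernelOp_le hrev') (by linarith) hb0.le hb1 fun g => ?_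
    obtain ⟨g', hg', e1, e2, e3⟩ := hJ g (Lp.stronglyMeasurable g).measurable (Lp.memLp g)
    have hae := hg'.coeFn_toLp
    refine ⟨hg'.toLp g', ?_, ?_⟩
    · rw [inner_eq_integral_mul, inner_eq_integral_mul,
        integral_mul_congr_ae (centredLp_ae_eq hf) EventuallyEq.rfl,
        integral_mul_congr_ae (centredLp_ae_eq hf') hae]
      exact e1
    · have q1 := (measurePreserving_fst_compProd (μ := μ') (P := P')).quasiMeasurePreserving.ae hae
      have q2 := (measurePreserving_snd_compProd hrev').quasiMeasurePreserving.ae hae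
      rw [inner_sub_smul_kernelOp, inner_sub_smul_kernelOp,
        integral_congr_ae (hae.mono fun z hz => congrArg (· ^ 2) hz),
        integral_congr_ae ((q1.and q2).mono fun p hp =>
          congrArg₂ (fun x y : ℝ => (x - y) ^ 2) hp.1 hp.2)]
      nlinarith [mul_le_mul_of_nonneg_left e2 (by linarith : 0 ≤ 1 - b),
        mul_le_mul_of_nonneg_left e3 (by linarith : 0 ≤ b / 2)]
  have hBle : ∀ᶠ b : ℝ in 𝓝[<] 1, ∑' k, autocov hrev hf k * b ^ k ≤ κ * (l' + 1) := by
    filter_upwards [hle, habel'.eventually_lt_const (lt_add_one l')] with b h1 h2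
    exact h1.trans (mul_le_mul_of_nonneg_left h2.le (by linarith))
  -- Finiteness for the second chain passes to the first: bounded Abel means bound the partial sums.
  have hB := hc.sum_range_even_le_of_abel hBle
  obtain ⟨l, hl⟩ := hc.exists_tendsto_mean_sum hB
  have hll : l ≤ κ * l' := le_of_tendsto_of_tendsto (hc.tendsto_abel hl) (habel'.const_mul κ) hle
  -- The only use of positivity: with no negative terms, every nonempty partial sum is at least its
  -- first term.
  have hcl' : autocov hrev' hf' 0 ≤ l' := by
    refine ge_of_tendsto hl' ?_
    filter_upwards [eventually_ge_atTop 1] with N hN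
    have (N : ℕ) (hN : 1 ≤ N) :
        autocov hrev' hf' 0 ≤ ∑ k ∈ Finset.range N, autocov hrev' hf' k :=
      Finset.single_le_sum (f := autocov hrev' hf')
        (fun k _ => autocov_nonneg hrev' hpos hf' k) (Finset.mem_range.2 hN)
    linarith [this N hN, this (N + 1) (by omega)]
  refine ⟨_, _, isAsymptoticVariance_ofReal hrev hf hB hl,
    isAsymptoticVariance_ofReal hrev' hf' hB' hl', ?_⟩
  rw [← ENNReal.ofReal_mul (by linarith), h0]
  refine ENNReal.ofReal_le_ofReal ?_
  -- The difference (2κ - 1)(2l' - c_0) - (2κl' - c_0) equals 2(κ - 1)(l' - c_0).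
  nlinarith [mul_le_mul_of_nonneg_left hcl' (by linarith : 0 ≤ κ - 1)]

end Comparison

/-! ### Accept-reject kernels -/

lemma lintegral_acceptReject {S : Type*} [MeasurableSpace S] (Q : Kernel S S) [IsSFiniteKernel Q]
    {α : S → S → ℝ≥0∞} (hα : Measurable (Function.uncurry α)) (z : S) {F : S → ℝ≥0∞}
    (hF : Measurable F) :
    ∫⁻ z', F z' ∂(acceptReject Q α z) =
      (1 - ∫⁻ z', α z z' ∂(Q z)) * F z + ∫⁻ z', α z z' * F z' ∂(Q z) := by
  rw [acceptReject_apply Q hα, lintegral_add_measure, lintegral_smul_measure,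
    lintegral_dirac' _ hF, lintegral_withDensity_eq_lintegral_mul _ hα.of_uncurry_left hF]
  rfl

/-! ### Reversibility and position marginal of the pseudo-marginal chain -/

namespace PseudoMarginal

variable {X : Type*} [MeasurableSpace X] {m : ℕ} (M : PseudoMarginal X m)

instance : IsProbabilityMeasure M.target := ⟨by
  rw [target, withDensity_apply _ MeasurableSet.univ, Measure.restrict_univ, M.lintegral_dens]⟩

/-- The reference measure `dx q_x(dw)` on `X × [0, ∞)^r`. -/
noncomputable def extRef (r : ℕ) (hr : r ≤ m) : Measure (X × (Fin r → ℝ≥0)) :=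
  M.ref ⊗ₘ M.weightLaw r hr

instance (r : ℕ) (hr : r ≤ m) : SFinite (M.extRef r hr) := by
  unfold extRef; infer_instance

lemma lintegral_extTarget (r : ℕ) (hr : r ≤ m) {F : X × (Fin r → ℝ≥0) → ℝ≥0∞}
    (hF : Measurable F) :
    ∫⁻ z, F z ∂(M.extTarget r hr) = ∫⁻ z, M.dens z.1 * avg z.2 * F z ∂(M.extRef r hr) := by
  have hd := M.measurable_dens
  have ha := measurable_avg (r := r)
  have hG : Measurable fun z : X × (Fin r → ℝ≥0) => avg z.2 * F z := by fun_prop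
  have hH : Measurable fun z : X × (Fin r → ℝ≥0) => (M.dens z.1 : ℝ≥0∞) * avg z.2 * F z := by
    fun_prop
  rw [extTarget, lintegral_withDensity_eq_lintegral_mul _ (by fun_prop) hF]
  change ∫⁻ z, avg z.2 * F z ∂_ = _
  rw [Measure.lintegral_compProd hG, target, lintegral_withDensity_eq_lintegral_mul _ (by fun_prop)
    hG.lintegral_kernel_prod_right', extRef, Measure.lintegral_compProd hH]
  refine lintegral_congr fun x => ?_
  rw [Pi.mul_apply, ← lintegral_const_mul _ (by fun_prop)]
  simp only [mul_assoc]

lemma lintegral_extProposal (r : ℕ) (hr : r ≤ m) (z : X × (Fin r → ℝ≥0))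
    {F : X × (Fin r → ℝ≥0) → ℝ≥0∞} (hF : Measurable F) :
    ∫⁻ z', F z' ∂(M.extProposal r hr z) = ∫⁻ z', M.q z.1 z'.1 * F z' ∂(M.extRef r hr) := by
  have hq : Measurable fun x' => (M.q z.1 x' : ℝ≥0∞) :=
    M.measurable_q.of_uncurry_left.coe_nnreal_ennreal
  have hH : Measurable fun z' : X × (Fin r → ℝ≥0) => (M.q z.1 z'.1 : ℝ≥0∞) * F z' :=
    (hq.comp measurable_fst).mul hF
  have hG : Measurable fun x => ∫⁻ w, F (x, w) ∂(M.weightLaw r hr x) :=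
    hF.lintegral_kernel_prod_right'
  rw [extProposal, Kernel.comap_apply, Kernel.lintegral_compProd _ _ _ hF, proposal,
    Kernel.withDensity_apply _ M.measurable_q.coe_nnreal_ennreal, Kernel.const_apply]
  simp only [Kernel.prodMkLeft_apply]
  rw [lintegral_withDensity_eq_lintegral_mul _ hq hG, extRef, Measure.lintegral_compProd hH]
  refine lintegral_congr fun x => ?_
  rw [Pi.mul_apply, ← lintegral_const_mul _ (by fun_prop)]

/-- The density of the accepted moves of the stationary chain. -/
noncomputable def moveDensity {r : ℕ} (z z' : X × (Fin r → ℝ≥0)) : ℝ≥0∞ :=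
  min (M.dens z.1 * M.q z.1 z'.1 * avg z.2) (M.dens z'.1 * M.q z'.1 z.1 * avg z'.2)

lemma moveDensity_comm {r : ℕ} (z z' : X × (Fin r → ℝ≥0)) :
    M.moveDensity z z' = M.moveDensity z' z := min_comm _ _

lemma measurable_moveDensity {r : ℕ} :
    Measurable fun p : (X × (Fin r → ℝ≥0)) × (X × (Fin r → ℝ≥0)) => M.moveDensity p.1 p.2 := by
  have hd := M.measurable_dens
  have ha := measurable_avg (r := r)
  have h1 : Measurable fun p : (X × (Fin r → ℝ≥0)) × (X × (Fin r → ℝ≥0)) => M.q p.1.1 p.2.1 :=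
    M.measurable_q.comp (f := fun p : (X × (Fin r → ℝ≥0)) × (X × (Fin r → ℝ≥0)) =>
      (p.1.1, p.2.1)) (by fun_prop)
  have h2 : Measurable fun p : (X × (Fin r → ℝ≥0)) × (X × (Fin r → ℝ≥0)) => M.q p.2.1 p.1.1 :=
    M.measurable_q.comp (f := fun p : (X × (Fin r → ℝ≥0)) × (X × (Fin r → ℝ≥0)) =>
      (p.2.1, p.1.1)) (by fun_prop)
  unfold moveDensity
  fun_prop

lemma avg_ne_top {r : ℕ} (hr : r ≠ 0) (w : Fin r → ℝ≥0) : avg w ≠ ∞ :=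
  ENNReal.div_ne_top (ENNReal.sum_ne_top.2 fun _ _ => ENNReal.coe_ne_top) (by exact_mod_cast hr)

/-- Detailed balance: multiplying the minimum in the acceptance probability by the forward flux
leaves the smaller of the forward and backward fluxes. If a factor of the forward flux is zero the
ratio cannot be cancelled, but both sides vanish. -/
lemma target_mul_accept {r : ℕ} (hr : r ≠ 0) (z z' : X × (Fin r → ℝ≥0)) :
    M.dens z.1 * avg z.2 * (M.q z.1 z'.1 * M.accept r z z') = M.moveDensity z z' := by
  have h1 : (M.dens z.1 : ℝ≥0∞) ≠ ∞ := ENNReal.coe_ne_top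
  have h2 : (M.q z.1 z'.1 : ℝ≥0∞) ≠ ∞ := ENNReal.coe_ne_top
  have h3 := avg_ne_top hr z.2
  rw [accept, moveDensity, ratio]
  generalize (M.dens z.1 : ℝ≥0∞) = d, (M.q z.1 z'.1 : ℝ≥0∞) = q, avg z.2 = a at *
  generalize (M.dens z'.1 * M.q z'.1 z.1 : ℝ≥0∞) = e, avg z'.2 = b
  by_cases hd : d = 0
  · simp [hd]
  by_cases hq : q = 0
  · simp [hq]
  by_cases ha : a = 0
  · simp [ha]
  rw [← mul_assoc, mul_right_comm d a q, mul_min, mul_one]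
  congr 1
  rw [div_eq_mul_inv, div_eq_mul_inv, ENNReal.mul_inv (.inl hd) (.inl h1)]
  calc d * q * a * (e * (d⁻¹ * q⁻¹) * (b * a⁻¹))
      = (d * d⁻¹) * (q * q⁻¹) * (a * a⁻¹) * (e * b) := by ring
    _ = e * b := by
      rw [ENNReal.mul_inv_cancel hd h1, ENNReal.mul_inv_cancel hq h2,
        ENNReal.mul_inv_cancel ha h3, one_mul, one_mul, one_mul]

instance (r : ℕ) (hr : r ≤ m) : SFinite (M.extTarget r hr) := by
  unfold extTarget; infer_instance

/-- A stationary transition is either a rejection, carried by the diagonal, or an accepted move with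
symmetric density. The diagonal part is swap invariant and contributes nothing to a Dirichlet form.
-/
lemma lintegral_extTarget_compProd_kernel {r : ℕ} (hr0 : r ≠ 0) (hr : r ≤ m)
    {F : (X × (Fin r → ℝ≥0)) × (X × (Fin r → ℝ≥0)) → ℝ≥0∞} (hF : Measurable F) :
    ∫⁻ p, F p ∂(M.extTarget r hr ⊗ₘ M.kernel r hr) =
      ∫⁻ z, (1 - ∫⁻ z', M.accept r z z' ∂(M.extProposal r hr z)) * F (z, z) ∂(M.extTarget r hr) +
      ∫⁻ z, ∫⁻ z', M.moveDensity z z' * F (z, z') ∂(M.extRef r hr) ∂(M.extRef r hr) := by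
  have hα := M.measurable_accept r
  have hd := M.measurable_dens
  have ha := measurable_avg (r := r)
  have hαF : Measurable fun p : (X × (Fin r → ℝ≥0)) × (X × (Fin r → ℝ≥0)) =>
    M.accept r p.1 p.2 * F p := hα.mul hF
  have h1 : Measurable fun z => (1 - ∫⁻ z', M.accept r z z' ∂(M.extProposal r hr z)) * F (z, z) :=
    (measurable_const.sub hα.lintegral_kernel_prod_right).mul (hF.comp (by fun_prop))
  have h2 : Measurable fun z => ∫⁻ z', M.accept r z z' * F (z, z') ∂(M.extProposal r hr z) :=
    hαF.lintegral_kernel_prod_right'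
  have e : ∀ z, ∫⁻ z', F (z, z') ∂(M.kernel r hr z) =
      (1 - ∫⁻ z', M.accept r z z' ∂(M.extProposal r hr z)) * F (z, z) +
        ∫⁻ z', M.accept r z z' * F (z, z') ∂(M.extProposal r hr z) := fun z =>
    lintegral_acceptReject (M.extProposal r hr) hα z (F := fun z' => F (z, z'))
      (hF.comp (by fun_prop))
  rw [Measure.lintegral_compProd hF, lintegral_congr e, lintegral_add_left h1]
  congr 1
  rw [lintegral_extTarget M r hr h2]
  refine lintegral_congr fun z => ?_
  have h3 : Measurable fun z' => M.accept r z z' * F (z, z') :=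
    hαF.comp (g := fun p : (X × (Fin r → ℝ≥0)) × (X × (Fin r → ℝ≥0)) =>
      M.accept r p.1 p.2 * F p) (f := fun z' => (z, z')) (by fun_prop)
  have hq : Measurable fun z' : X × (Fin r → ℝ≥0) => (M.q z.1 z'.1 : ℝ≥0∞) :=
    M.measurable_q.of_uncurry_left.coe_nnreal_ennreal.comp measurable_fst
  rw [lintegral_extProposal M r hr z h3, ← lintegral_const_mul (f := fun z' => (M.q z.1 z'.1 : ℝ≥0∞) *
    (M.accept r z z' * F (z, z'))) _ (hq.mul h3)]
  refine lintegral_congr fun z' => ?_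
  rw [← target_mul_accept M hr0]
  ring

/-- Reversibility of the pseudo-marginal kernel. -/
lemma measurePreserving_swap {r : ℕ} (hr0 : r ≠ 0) (hr : r ≤ m) :
    MeasurePreserving Prod.swap (M.extTarget r hr ⊗ₘ M.kernel r hr)
      (M.extTarget r hr ⊗ₘ M.kernel r hr) := by
  refine ⟨measurable_swap, Measure.ext_of_lintegral _ fun F hF => ?_⟩
  rw [lintegral_map hF measurable_swap,
    lintegral_extTarget_compProd_kernel M hr0 hr (F := fun p => F p.swap)
      (hF.comp measurable_swap), lintegral_extTarget_compProd_kernel M hr0 hr hF]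
  simp only [Prod.swap_prod_mk]
  congr 1
  have h : Measurable fun p : (X × (Fin r → ℝ≥0)) × (X × (Fin r → ℝ≥0)) =>
    M.moveDensity p.1 p.2 * F (p.2, p.1) := M.measurable_moveDensity.mul (hF.comp measurable_swap)
  rw [lintegral_lintegral_swap h.aemeasurable]
  simp only [moveDensity_comm]

lemma lintegral_avg_weightLaw {r : ℕ} (hr0 : r ≠ 0) (hr : r ≤ m) (x : X) :
    ∫⁻ w, avg w ∂(M.weightLaw r hr x) = 1 := by
  have hr' : (r : ℝ≥0∞) ≠ 0 := by exact_mod_cast hr0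
  rw [weightLaw, Kernel.map_apply _ (by fun_prop), lintegral_map measurable_avg (by fun_prop)]
  simp only [avg, div_eq_mul_inv]
  rw [lintegral_mul_const _ (by fun_prop), lintegral_finsetSum _ (by fun_prop)]
  simp [M.lintegral_weight, ENNReal.mul_inv_cancel hr']

/-- The first marginal of the extended target is the target. -/
lemma measurePreserving_fst_extTarget {r : ℕ} (hr0 : r ≠ 0) (hr : r ≤ m) :
    MeasurePreserving Prod.fst (M.extTarget r hr) M.target := by
  have hd := M.measurable_dens
  have ha := measurable_avg (r := r)
  refine ⟨measurable_fst, Measure.ext_of_lintegral _ fun F hF => ?_⟩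
  rw [lintegral_map hF measurable_fst, lintegral_extTarget M r hr (by fun_prop), extRef,
    Measure.lintegral_compProd (by fun_prop), target,
    lintegral_withDensity_eq_lintegral_mul _ (by fun_prop) hF]
  refine lintegral_congr fun x => ?_
  simp only [mul_right_comm _ (avg _)]
  rw [lintegral_const_mul _ ha, lintegral_avg_weightLaw M hr0 hr, mul_one]
  rfl

lemma isProbabilityMeasure_extTarget {r : ℕ} (hr0 : r ≠ 0) (hr : r ≤ m) :
    IsProbabilityMeasure (M.extTarget r hr) := by
  have h := (measurePreserving_fst_extTarget M hr0 hr).measure_preimage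
    (MeasurableSet.univ (α := X)).nullMeasurableSet
  exact ⟨by simpa using h⟩

end PseudoMarginal

namespace PseudoMarginal

/-! ### Rotations of the weights -/

section Rotation

variable {X : Type*} [MeasurableSpace X] {m : ℕ} [NeZero m] (M : PseudoMarginal X m) {s : ℕ}
  (hsm : s ≤ m)

/-- The first `s` of the `m` weights, after a cyclic shift by `k`. -/
def rotate (k : Fin m) (z : X × (Fin m → ℝ≥0)) : X × (Fin s → ℝ≥0) :=
  (z.1, fun i => z.2 (Fin.castLE hsm i + k))

omit [NeZero m] in
lemma measurable_rotate (k : Fin m) : Measurable (rotate (X := X) hsm k) := by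
  unfold rotate; fun_prop

omit [NeZero m] in
lemma weightLaw_self : M.weightLaw m le_rfl = M.weights := by
  ext1 x
  rw [weightLaw, Kernel.map_apply _ (by fun_prop)]
  exact Measure.map_id

/-- Exchangeability enters here, and only through cyclic shifts. -/
lemma map_weightLaw_shift (k : Fin m) (x : X) :
    (M.weightLaw m le_rfl x).map (fun w i => w (Fin.castLE hsm i + k)) = M.weightLaw s hsm x := by
  rw [weightLaw_self, weightLaw, Kernel.map_apply _ (by fun_prop)]
  conv_rhs => rw [← M.exchangeable x (Equiv.addRight k),
    Measure.map_map (by fun_prop) (by fun_prop)]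
  rfl

lemma measurePreserving_rotate (k : Fin m) :
    MeasurePreserving (rotate hsm k) (M.extRef m le_rfl) (M.extRef s hsm) := by
  refine ⟨measurable_rotate hsm k, Measure.ext_of_lintegral _ fun F hF => ?_⟩
  have hR : Measurable fun z => F (rotate hsm k z) := hF.comp (measurable_rotate hsm k)
  rw [lintegral_map hF (measurable_rotate hsm k), extRef, extRef,
    Measure.lintegral_compProd hR, Measure.lintegral_compProd hF]
  refine lintegral_congr fun x => ?_
  rw [← map_weightLaw_shift M hsm k, lintegral_map (by fun_prop) (by fun_prop)]
  rfl

-- For each slot i the map k ↦ i + k is a bijection of `Fin m`, so each weight lies in exactly s of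
-- the m windows.
omit [MeasurableSpace X] in
lemma sum_avg_rotate (hs : s ≠ 0) (z : X × (Fin m → ℝ≥0)) :
    ∑ k, avg (rotate hsm k z).2 = m * avg z.2 := by
  have hs' : (s : ℝ≥0∞) ≠ 0 := by exact_mod_cast hs
  have hm' : (m : ℝ≥0∞) ≠ 0 := by exact_mod_cast NeZero.ne m
  simp only [avg, rotate, div_eq_mul_inv]
  rw [← Finset.sum_mul, Finset.sum_comm]
  have (i : Fin s) : ∑ k, (z.2 (Fin.castLE hsm i + k) : ℝ≥0∞) = ∑ k, (z.2 k : ℝ≥0∞) :=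
    Fintype.sum_equiv (Equiv.addLeft (Fin.castLE hsm i)) _ _ fun _ => rfl
  simp only [this, Finset.sum_const, Finset.card_univ, Fintype.card_fin, nsmul_eq_mul]
  rw [mul_right_comm, ENNReal.mul_inv_cancel hs' (ENNReal.natCast_ne_top s), one_mul,
    mul_left_comm, ENNReal.mul_inv_cancel hm' (ENNReal.natCast_ne_top m), mul_one]

-- A window has s distinct indices, so its sum is at most that of all m weights. This yields the
-- bound 1/s on window probabilities.
omit [MeasurableSpace X] in
lemma avg_rotate_le (k : Fin m) (z : X × (Fin m → ℝ≥0)) :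
    avg (rotate hsm k z).2 ≤ (s : ℝ≥0∞)⁻¹ * (m * avg z.2) := by
  have hm' : (m : ℝ≥0∞) ≠ 0 := by exact_mod_cast NeZero.ne m
  simp only [avg, rotate]
  rw [ENNReal.mul_div_cancel hm' (ENNReal.natCast_ne_top m), div_eq_mul_inv, mul_comm]
  gcongr
  have hinj : Function.Injective fun i : Fin s => Fin.castLE hsm i + k :=
    (add_left_injective k).comp (Fin.castLE_injective hsm)
  rw [← Finset.sum_image (f := fun j => (z.2 j : ℝ≥0∞)) hinj.injOn]
  exact Finset.sum_le_sum_of_subset (Finset.subset_univ _)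

/-- The probability of choosing the `k`-th rotation, proportional to the average of the
weights it selects. -/
noncomputable def rotProb (k : Fin m) (z : X × (Fin m → ℝ≥0)) : ℝ≥0∞ :=
  avg (rotate hsm k z).2 / (m * avg z.2)

omit [NeZero m] in
lemma measurable_rotProb (k : Fin m) : Measurable (rotProb (X := X) hsm k) :=
  (measurable_avg.comp (measurable_rotate hsm k).snd).div
    (measurable_const.mul (measurable_avg.comp measurable_snd))

omit [MeasurableSpace X] in
lemma mul_avg_ne_top (z : X × (Fin m → ℝ≥0)) : (m : ℝ≥0∞) * avg z.2 ≠ ∞ :=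
  ENNReal.mul_ne_top (ENNReal.natCast_ne_top m) (avg_ne_top (NeZero.ne m) _)

omit [MeasurableSpace X] in
lemma sum_rotProb (hs : s ≠ 0) (z : X × (Fin m → ℝ≥0)) (hz : avg z.2 ≠ 0) :
    ∑ k, rotProb hsm k z = 1 := by
  have hm' : (m : ℝ≥0∞) ≠ 0 := by exact_mod_cast NeZero.ne m
  simp only [rotProb, div_eq_mul_inv]
  rw [← Finset.sum_mul, sum_avg_rotate hsm hs,
    ENNReal.mul_inv_cancel (mul_ne_zero hm' hz) (mul_avg_ne_top z)]

omit [MeasurableSpace X] in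
lemma rotProb_le (k : Fin m) (z : X × (Fin m → ℝ≥0)) : rotProb hsm k z ≤ (s : ℝ≥0∞)⁻¹ :=
  ENNReal.div_le_of_le_mul (avg_rotate_le hsm k z)

omit [MeasurableSpace X] in
lemma rotProb_eq_zero (k : Fin m) {z : X × (Fin m → ℝ≥0)} (hz : avg z.2 = 0) :
    rotProb hsm k z = 0 := by
  have h := avg_rotate_le hsm k z
  rw [hz, mul_zero, mul_zero, nonpos_iff_eq_zero] at h
  rw [rotProb, h, ENNReal.zero_div]

omit [MeasurableSpace X] in
lemma rotProb_ne_top (hs : s ≠ 0) (k : Fin m) (z : X × (Fin m → ℝ≥0)) : rotProb hsm k z ≠ ∞ :=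
  ne_top_of_le_ne_top (ENNReal.inv_ne_top.2 (by exact_mod_cast hs)) (rotProb_le hsm k z)

omit [MeasurableSpace X] in
lemma sum_rotProb_le (hs : s ≠ 0) (z : X × (Fin m → ℝ≥0)) : ∑ k, rotProb hsm k z ≤ 1 := by
  by_cases hz : avg z.2 = 0
  · simp [rotProb_eq_zero hsm _ hz]
  · exact (sum_rotProb hsm hs z hz).le

omit [MeasurableSpace X] in
lemma avg_mul_rotProb (k : Fin m) (z : X × (Fin m → ℝ≥0)) :
    avg z.2 * rotProb hsm k z = (m : ℝ≥0∞)⁻¹ * avg (rotate hsm k z).2 := by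
  have hm' : (m : ℝ≥0∞) ≠ 0 := by exact_mod_cast NeZero.ne m
  by_cases hz : avg z.2 = 0
  · have h := avg_rotate_le hsm k z
    rw [hz, mul_zero, mul_zero, nonpos_iff_eq_zero] at h
    rw [hz, h, zero_mul, mul_zero]
  · rw [rotProb, div_eq_mul_inv, ENNReal.mul_inv (.inl hm') (.inl (ENNReal.natCast_ne_top m))]
    calc avg z.2 * (avg (rotate hsm k z).2 * ((m : ℝ≥0∞)⁻¹ * (avg z.2)⁻¹))
        = (avg z.2 * (avg z.2)⁻¹) * ((m : ℝ≥0∞)⁻¹ * avg (rotate hsm k z).2) := by ring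
      _ = _ := by rw [ENNReal.mul_inv_cancel hz (avg_ne_top (NeZero.ne m) _), one_mul]

/-- The extended target with `s` weights is obtained from the one with `m` weights by a random
rotation. -/
lemma extTarget_eq_sum :
    M.extTarget s hsm = ∑ k, ((M.extTarget m le_rfl).withDensity (rotProb hsm k)).map
      (rotate hsm k) := by
  have hm' : (m : ℝ≥0∞) ≠ 0 := by exact_mod_cast NeZero.ne m
  have hd := M.measurable_dens
  have ha := measurable_avg (r := s)
  have ha' := measurable_avg (r := m)
  refine Measure.ext_of_lintegral _ fun F hF => ?_
  have hG : Measurable fun z : X × (Fin s → ℝ≥0) => (M.dens z.1 : ℝ≥0∞) * avg z.2 * F z := by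
    fun_prop
  rw [lintegral_finsetSum_measure]
  have e : ∀ k, ∫⁻ z, F z ∂(((M.extTarget m le_rfl).withDensity (rotProb hsm k)).map
      (rotate hsm k)) = (m : ℝ≥0∞)⁻¹ * ∫⁻ z, F z ∂(M.extTarget s hsm) := fun k => by
    have hR : Measurable fun z => F (rotate hsm k z) := hF.comp (measurable_rotate hsm k)
    have hp := measurable_rotProb (X := X) hsm k
    rw [lintegral_map hF (measurable_rotate hsm k),
      lintegral_withDensity_eq_lintegral_mul _ hp hR, lintegral_extTarget _ _ _ (hp.mul hR),
      lintegral_extTarget _ _ _ hF, ← (measurePreserving_rotate M hsm k).lintegral_comp hG,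
      ← lintegral_const_mul (f := fun z => (M.dens (rotate hsm k z).1 : ℝ≥0∞) *
        avg (rotate hsm k z).2 * F (rotate hsm k z)) _ (hG.comp (measurable_rotate hsm k))]
    refine lintegral_congr fun z => ?_
    have h1 := avg_mul_rotProb hsm k z
    change (M.dens z.1 : ℝ≥0∞) * avg z.2 * (rotProb hsm k z * F (rotate hsm k z)) =
      (m : ℝ≥0∞)⁻¹ * ((M.dens z.1 : ℝ≥0∞) * avg (rotate hsm k z).2 * F (rotate hsm k z))
    calc _ = (M.dens z.1 : ℝ≥0∞) * (avg z.2 * rotProb hsm k z) * F (rotate hsm k z) := by ring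
      _ = _ := by rw [h1]; ring
  simp only [e, Finset.sum_const, Finset.card_univ, Fintype.card_fin, nsmul_eq_mul]
  rw [← mul_assoc, ENNReal.mul_inv_cancel hm' (ENNReal.natCast_ne_top m), one_mul]

lemma lintegral_sum_rotProb_mul {F : X × (Fin s → ℝ≥0) → ℝ≥0∞} (hF : Measurable F) :
    ∫⁻ z, ∑ k, rotProb hsm k z * F (rotate hsm k z) ∂(M.extTarget m le_rfl) =
      ∫⁻ z, F z ∂(M.extTarget s hsm) := by
  have hR (k : Fin m) : Measurable fun z => F (rotate hsm k z) :=
    hF.comp (measurable_rotate hsm k)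
  have h (k : Fin m) : Measurable fun z => rotProb hsm k z * F (rotate hsm k z) :=
    (measurable_rotProb hsm k).mul (hR k)
  rw [extTarget_eq_sum M hsm, lintegral_finsetSum_measure, lintegral_finsetSum _ fun k _ => h k]
  refine Finset.sum_congr rfl fun k _ => ?_
  rw [lintegral_map hF (measurable_rotate hsm k), lintegral_withDensity_eq_lintegral_mul _
    (measurable_rotProb hsm k) (hR k)]
  rfl

lemma integral_sum_rotProb_mul (hs : s ≠ 0) {F : X × (Fin s → ℝ≥0) → ℝ}
    (hF : Integrable F (M.extTarget s hsm)) :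
    ∫ z, ∑ k, (rotProb hsm k z).toReal * F (rotate hsm k z) ∂(M.extTarget m le_rfl) =
      ∫ z, F z ∂(M.extTarget s hsm) := by
  -- Each summand of the mixture is dominated by the whole, so integrability passes to it.
  have hle (k : Fin m) : ((M.extTarget m le_rfl).withDensity (rotProb hsm k)).map (rotate hsm k) ≤
      M.extTarget s hsm := by
    rw [extTarget_eq_sum M hsm]
    exact Finset.single_le_sum (f := fun k =>
      ((M.extTarget m le_rfl).withDensity (rotProb hsm k)).map (rotate hsm k))
      (fun _ _ => Measure.zero_le _) (Finset.mem_univ k)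
  have hi (k : Fin m) := hF.mono_measure (hle k)
  have hmr (k : Fin m) := (measurable_rotate (X := X) hsm k).aemeasurable
    (μ := (M.extTarget m le_rfl).withDensity (rotProb hsm k))
  have hft (k : Fin m) : ∀ᵐ z ∂(M.extTarget m le_rfl), rotProb hsm k z < ∞ :=
    Eventually.of_forall fun z => (rotProb_ne_top hsm hs k z).lt_top
  have hi' (k : Fin m) : Integrable (fun z => (rotProb hsm k z).toReal * F (rotate hsm k z))
      (M.extTarget m le_rfl) := by
    have h := (integrable_map_measure (hi k).aestronglyMeasurable (hmr k)).1 (hi k)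
    exact (integrable_withDensity_iff_integrable_smul' (measurable_rotProb hsm k) (hft k)).1 h
  rw [integral_finsetSum _ fun k _ => hi' k]
  conv_rhs => rw [extTarget_eq_sum M hsm]
  rw [integral_finsetSum_measure fun k _ => hi k]
  refine Finset.sum_congr rfl fun k _ => ?_
  rw [integral_map (hmr k) (hi k).aestronglyMeasurable,
    integral_withDensity_eq_integral_toReal_smul (measurable_rotProb hsm k) (hft k)]
  rfl

/-- In each flux of the minimum, the probability at the point whose average appears turns that
average into 1/m of the window's, and the other probability is bounded by 1/s. -/
lemma moveDensity_mul_rotProb_le (k l : Fin m) (z z' : X × (Fin m → ℝ≥0)) :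
    M.moveDensity z z' * (rotProb hsm k z * rotProb hsm l z') ≤
      (m : ℝ≥0∞)⁻¹ * (s : ℝ≥0∞)⁻¹ * M.moveDensity (rotate hsm k z) (rotate hsm l z') := by
  simp only [moveDensity]
  rw [mul_min]
  refine le_min ?_ ?_
  · calc _ ≤ (M.dens z.1 * M.q z.1 z'.1 * avg z.2) * (rotProb hsm k z * (s : ℝ≥0∞)⁻¹) := by
          gcongr
          · exact min_le_left _ _
          · exact rotProb_le hsm l z'
      _ = M.dens z.1 * M.q z.1 z'.1 * (avg z.2 * rotProb hsm k z) * (s : ℝ≥0∞)⁻¹ := by ring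
      _ = (m : ℝ≥0∞)⁻¹ * (s : ℝ≥0∞)⁻¹ *
          (M.dens z.1 * M.q z.1 z'.1 * avg (rotate hsm k z).2) := by
        rw [avg_mul_rotProb]; ring
  · calc _ ≤ (M.dens z'.1 * M.q z'.1 z.1 * avg z'.2) * ((s : ℝ≥0∞)⁻¹ * rotProb hsm l z') := by
          gcongr
          · exact min_le_right _ _
          · exact rotProb_le hsm k z
      _ = M.dens z'.1 * M.q z'.1 z.1 * (avg z'.2 * rotProb hsm l z') * (s : ℝ≥0∞)⁻¹ := by ring
      _ = (m : ℝ≥0∞)⁻¹ * (s : ℝ≥0∞)⁻¹ *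
          (M.dens z'.1 * M.q z'.1 z.1 * avg (rotate hsm l z').2) := by
        rw [avg_mul_rotProb]; ring

/-- The average of `g` over the random rotation. -/
noncomputable def rotAvg (g : X × (Fin s → ℝ≥0) → ℝ) (z : X × (Fin m → ℝ≥0)) : ℝ :=
  ∑ k, (rotProb hsm k z).toReal * g (rotate hsm k z)

omit [NeZero m] in
lemma measurable_rotAvg {g : X × (Fin s → ℝ≥0) → ℝ} (hg : Measurable g) :
    Measurable (rotAvg hsm g) :=
  Finset.measurable_sum _ fun k _ => (measurable_rotProb hsm k).ennreal_toReal.mul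
    (hg.comp (measurable_rotate hsm k))

end Rotation

/-- Jensen's inequality for finite sums, in `[0, ∞]`. -/
lemma ofReal_sum_mul_sq_le {ι : Type*} (t : Finset ι) (p : ι → ℝ≥0∞) (hp : ∀ i, p i ≠ ∞)
    (h1 : ∑ i ∈ t, p i ≤ 1) (g : ι → ℝ) :
    ENNReal.ofReal ((∑ i ∈ t, (p i).toReal * g i) ^ 2) ≤
      ∑ i ∈ t, p i * ENNReal.ofReal (g i ^ 2) := by
  have h2 : ∑ i ∈ t, (p i).toReal ≤ 1 := by
    rw [← ENNReal.toReal_sum fun i _ => hp i]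
    exact ENNReal.toReal_le_of_le_ofReal zero_le_one (by simpa using h1)
  have h3 : (∑ i ∈ t, (p i).toReal * g i) ^ 2 ≤ ∑ i ∈ t, (p i).toReal * g i ^ 2 := by
    refine (Finset.sum_sq_le_sum_mul_sum_of_sq_le_mul t (f := fun i => (p i).toReal)
      (g := fun i => (p i).toReal * g i ^ 2) (fun _ _ => ENNReal.toReal_nonneg)
      (fun _ _ => by positivity) (fun _ _ => by ring_nf; rfl)).trans ?_
    exact mul_le_of_le_one_left (Finset.sum_nonneg fun _ _ => by positivity) h2
  refine (ENNReal.ofReal_le_ofReal h3).trans_eq ?_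
  rw [ENNReal.ofReal_sum_of_nonneg fun _ _ => by positivity]
  refine Finset.sum_congr rfl fun i _ => ?_
  rw [ENNReal.ofReal_mul ENNReal.toReal_nonneg, ENNReal.ofReal_toReal (hp i)]

/-! ### Norm and Dirichlet form of the rotation average -/

section Energy

variable {X : Type*} [MeasurableSpace X] {m : ℕ} [NeZero m] (M : PseudoMarginal X m) {s : ℕ}
  (hsm : s ≤ m)

lemma lintegral_rotAvg_sq_le (hs : s ≠ 0) {g : X × (Fin s → ℝ≥0) → ℝ} (hg : Measurable g) :
    ∫⁻ z, ENNReal.ofReal (rotAvg hsm g z ^ 2) ∂(M.extTarget m le_rfl) ≤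
      ∫⁻ z, ENNReal.ofReal (g z ^ 2) ∂(M.extTarget s hsm) := by
  rw [← lintegral_sum_rotProb_mul M hsm (by fun_prop)]
  exact lintegral_mono fun z => ofReal_sum_mul_sq_le _ _ (rotProb_ne_top hsm hs · z)
    (sum_rotProb_le hsm hs z) _

/-- Choosing the two windows independently writes the difference of averages as one average of
differences, to which Jensen applies. This needs probabilities with total exactly 1, so zero
averages are set aside; there the move density vanishes. -/
lemma moveDensity_mul_rotAvg_sub_sq_le (hs : s ≠ 0) (g : X × (Fin s → ℝ≥0) → ℝ)
    (z z' : X × (Fin m → ℝ≥0)) :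
    M.moveDensity z z' * ENNReal.ofReal ((rotAvg hsm g z - rotAvg hsm g z') ^ 2) ≤
      ∑ k, ∑ l, (m : ℝ≥0∞)⁻¹ * (s : ℝ≥0∞)⁻¹ *
        (M.moveDensity (rotate hsm k z) (rotate hsm l z') *
          ENNReal.ofReal ((g (rotate hsm k z) - g (rotate hsm l z')) ^ 2)) := by
  by_cases hz : avg z.2 = 0
  · simp [moveDensity, hz]
  by_cases hz' : avg z'.2 = 0
  · simp [moveDensity, hz']
  have hreal {z : X × (Fin m → ℝ≥0)} (hz : avg z.2 ≠ 0) : ∑ k, (rotProb hsm k z).toReal = 1 := by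
    rw [← ENNReal.toReal_sum fun k _ => rotProb_ne_top hsm hs k z, sum_rotProb hsm hs z hz,
      ENNReal.toReal_one]
  have e1 : rotAvg hsm g z - rotAvg hsm g z' = ∑ kl : Fin m × Fin m,
      (rotProb hsm kl.1 z * rotProb hsm kl.2 z').toReal *
        (g (rotate hsm kl.1 z) - g (rotate hsm kl.2 z')) := by
    simp only [ENNReal.toReal_mul, Fintype.sum_prod_type, mul_sub, Finset.sum_sub_distrib, rotAvg]
    congr 1
    · refine Finset.sum_congr rfl fun k _ => ?_
      rw [← Finset.sum_mul, ← Finset.mul_sum, hreal hz', mul_one]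
    · rw [Finset.sum_comm]
      refine Finset.sum_congr rfl fun l _ => ?_
      simp only [mul_assoc]
      rw [← Finset.sum_mul, hreal hz, one_mul]
  have h1 : ∑ kl : Fin m × Fin m, rotProb hsm kl.1 z * rotProb hsm kl.2 z' ≤ 1 := by
    rw [Fintype.sum_prod_type]
    dsimp only
    rw [← Finset.sum_mul_sum, sum_rotProb hsm hs z hz,
      sum_rotProb hsm hs z' hz', one_mul]
  rw [e1]
  refine (mul_le_mul_right (ofReal_sum_mul_sq_le _ _ (fun kl => ENNReal.mul_ne_top
    (rotProb_ne_top hsm hs _ _) (rotProb_ne_top hsm hs _ _)) h1 _) _).trans ?_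
  rw [Finset.mul_sum, Fintype.sum_prod_type]
  refine Finset.sum_le_sum fun k _ => Finset.sum_le_sum fun l _ => ?_
  rw [← mul_assoc, ← mul_assoc (_ * _)]
  exact mul_le_mul_left (moveDensity_mul_rotProb_le M hsm k l z z') _

lemma lintegral_sum_rotate {D : X × (Fin s → ℝ≥0) → X × (Fin s → ℝ≥0) → ℝ≥0∞}
    (hD : Measurable (Function.uncurry D)) (c : ℝ≥0∞) :
    ∫⁻ z, ∫⁻ z', ∑ k, ∑ l, c * D (rotate hsm k z) (rotate hsm l z') ∂(M.extRef m le_rfl)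
        ∂(M.extRef m le_rfl) =
      m * (m * (c * ∫⁻ z, ∫⁻ z', D z z' ∂(M.extRef s hsm) ∂(M.extRef s hsm))) := by
  have hE : Measurable fun z => ∫⁻ z', D z z' ∂(M.extRef s hsm) := hD.lintegral_prod_right'
  have hDz (l : Fin m) (z : X × (Fin s → ℝ≥0)) : Measurable fun z' => D z (rotate hsm l z') :=
    hD.of_uncurry_left.comp (measurable_rotate hsm l)
  have h1 (l : Fin m) (z : X × (Fin s → ℝ≥0)) : ∫⁻ z', D z (rotate hsm l z') ∂(M.extRef m le_rfl) =
      ∫⁻ z', D z z' ∂(M.extRef s hsm) :=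
    (measurePreserving_rotate M hsm l).lintegral_comp hD.of_uncurry_left
  have h2 (z : X × (Fin m → ℝ≥0)) :
      ∫⁻ z', ∑ k, ∑ l, c * D (rotate hsm k z) (rotate hsm l z') ∂(M.extRef m le_rfl) =
        ∑ k, m * (c * ∫⁻ z', D (rotate hsm k z) z' ∂(M.extRef s hsm)) := by
    rw [lintegral_finsetSum _ fun k _ => Finset.measurable_sum _ fun l _ => (hDz l _).const_mul _]
    refine Finset.sum_congr rfl fun k _ => ?_
    rw [lintegral_finsetSum _ fun l _ => (hDz l _).const_mul _]
    simp only [lintegral_const_mul _ (hDz _ _), h1, Finset.sum_const, Finset.card_univ,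
      Fintype.card_fin, nsmul_eq_mul]
  have hEk (k : Fin m) : Measurable fun z => ∫⁻ z', D (rotate hsm k z) z' ∂(M.extRef s hsm) :=
    hE.comp (measurable_rotate hsm k)
  have h3 (k : Fin m) : ∫⁻ z, m * (c * ∫⁻ z', D (rotate hsm k z) z' ∂(M.extRef s hsm))
      ∂(M.extRef m le_rfl) =
      m * (c * ∫⁻ z, ∫⁻ z', D z z' ∂(M.extRef s hsm) ∂(M.extRef s hsm)) := by
    rw [lintegral_const_mul _ ((hEk k).const_mul _), lintegral_const_mul _ (hEk k),
      (measurePreserving_rotate M hsm k).lintegral_comp hE]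
  simp only [h2]
  rw [lintegral_finsetSum _ fun k _ => ((hEk k).const_mul _).const_mul _]
  simp only [h3, Finset.sum_const, Finset.card_univ, Fintype.card_fin, nsmul_eq_mul]

lemma lintegral_rotAvg_sub_sq_le (hs : s ≠ 0) {g : X × (Fin s → ℝ≥0) → ℝ} (hg : Measurable g) :
    ∫⁻ p, ENNReal.ofReal ((rotAvg hsm g p.1 - rotAvg hsm g p.2) ^ 2)
        ∂(M.extTarget m le_rfl ⊗ₘ M.kernel m le_rfl) ≤
      (m / s : ℝ≥0∞) * ∫⁻ p, ENNReal.ofReal ((g p.1 - g p.2) ^ 2)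
        ∂(M.extTarget s hsm ⊗ₘ M.kernel s hsm) := by
  have hm' : (m : ℝ≥0∞) ≠ 0 := by exact_mod_cast NeZero.ne m
  have hG := measurable_rotAvg hsm hg
  have h1 := lintegral_extTarget_compProd_kernel M (NeZero.ne m) le_rfl
    (F := fun p => ENNReal.ofReal ((rotAvg hsm g p.1 - rotAvg hsm g p.2) ^ 2)) (by fun_prop)
  have h2 := lintegral_extTarget_compProd_kernel M hs hsm
    (F := fun p => ENNReal.ofReal ((g p.1 - g p.2) ^ 2)) (by fun_prop)
  simp only [sub_self, zero_pow two_ne_zero, ENNReal.ofReal_zero, mul_zero, lintegral_zero,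
    zero_add] at h1 h2
  rw [h1, h2]
  have hD : Measurable (Function.uncurry fun z z' : X × (Fin s → ℝ≥0) =>
      M.moveDensity z z' * ENNReal.ofReal ((g z - g z') ^ 2)) :=
    M.measurable_moveDensity.mul (by fun_prop)
  refine (lintegral_mono fun z => lintegral_mono fun z' =>
    moveDensity_mul_rotAvg_sub_sq_le M hsm hs g z z').trans_eq ?_
  rw [lintegral_sum_rotate M hsm hD]
  generalize ∫⁻ z, ∫⁻ z', M.moveDensity z z' * ENNReal.ofReal ((g z - g z') ^ 2)
    ∂(M.extRef s hsm) ∂(M.extRef s hsm) = I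
  rw [div_eq_mul_inv]
  -- The m² pairs of windows, at 1/(ms) each, produce the constant m/s.
  calc (m : ℝ≥0∞) * (m * ((m : ℝ≥0∞)⁻¹ * (s : ℝ≥0∞)⁻¹ * I))
      = (m * (m : ℝ≥0∞)⁻¹) * (m * (s : ℝ≥0∞)⁻¹ * I) := by ring
    _ = m * (s : ℝ≥0∞)⁻¹ * I := by
      rw [ENNReal.mul_inv_cancel hm' (ENNReal.natCast_ne_top m), one_mul]

end Energy

end PseudoMarginal

/-- Comparison of integrals of squares from a comparison of lower integrals. -/
lemma integral_sq_le_of_lintegral {Ω Ω' : Type*} [MeasurableSpace Ω] [MeasurableSpace Ω']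
    {ρ : Measure Ω} {ρ' : Measure Ω'} {u : Ω → ℝ} {v : Ω' → ℝ} (hu : AEStronglyMeasurable u ρ)
    (hv : MemLp v 2 ρ') {c : ℝ≥0∞} (hc : c ≠ ∞)
    (h : ∫⁻ ω, ENNReal.ofReal (u ω ^ 2) ∂ρ ≤ c * ∫⁻ ω, ENNReal.ofReal (v ω ^ 2) ∂ρ') :
    ∫ ω, u ω ^ 2 ∂ρ ≤ c.toReal * ∫ ω, v ω ^ 2 ∂ρ' := by
  have hfin : ∫⁻ ω, ENNReal.ofReal (v ω ^ 2) ∂ρ' ≠ ∞ := by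
    rw [← ofReal_integral_eq_lintegral_ofReal hv.integrable_sq
      (Eventually.of_forall fun _ => sq_nonneg _)]
    exact ENNReal.ofReal_ne_top
  rw [integral_eq_lintegral_of_nonneg_ae (Eventually.of_forall fun _ => sq_nonneg _) (hu.pow 2),
    integral_eq_lintegral_of_nonneg_ae (Eventually.of_forall fun _ => sq_nonneg _)
      (hv.aestronglyMeasurable.pow 2), ← ENNReal.toReal_mul]
  exact ENNReal.toReal_mono (ENNReal.mul_ne_top hc hfin) h

lemma memLp_two_of_lintegral_sq_le {Ω Ω' : Type*} [MeasurableSpace Ω] [MeasurableSpace Ω']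
    {ρ : Measure Ω} {ρ' : Measure Ω'} {u : Ω → ℝ} {v : Ω' → ℝ} (hu : AEStronglyMeasurable u ρ)
    (hv : MemLp v 2 ρ')
    (h : ∫⁻ ω, ENNReal.ofReal (u ω ^ 2) ∂ρ ≤ ∫⁻ ω, ENNReal.ofReal (v ω ^ 2) ∂ρ') :
    MemLp u 2 ρ := by
  rw [memLp_two_iff_integrable_sq hu]
  refine ⟨hu.pow 2, ?_⟩
  rw [hasFiniteIntegral_iff_ofReal (Eventually.of_forall fun _ => sq_nonneg _)]
  refine h.trans_lt ?_
  rw [← hasFiniteIntegral_iff_ofReal (Eventually.of_forall fun _ => sq_nonneg _)]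
  exact hv.integrable_sq.2

theorem corollary2 {X : Type*} [MeasurableSpace X] {s m : ℕ} (hs : 1 ≤ s) (hsm : s ≤ m)
    (M : PseudoMarginal X m)
    (hpos : IsPositiveKernel (M.extTarget m le_rfl) (M.kernel m le_rfl))
    (φ : X → ℝ) (hφ : MemLp φ 2 M.target) :
    ∃ v_s v_m : ℝ≥0∞,
      IsAsymptoticVariance (M.extTarget s hsm) (M.kernel s hsm) (fun z => φ z.1) v_s ∧
      IsAsymptoticVariance (M.extTarget m le_rfl) (M.kernel m le_rfl) (fun z => φ z.1) v_m ∧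
      v_s ≤ ENNReal.ofReal (2 * m / s - 1) * v_m := by
  have hs0 : s ≠ 0 := by omega
  have hm0 : m ≠ 0 := by omega
  have : NeZero m := ⟨hm0⟩
  have := M.isProbabilityMeasure_extTarget hs0 hsm
  have := M.isProbabilityMeasure_extTarget hm0 le_rfl
  have hps := M.measurePreserving_fst_extTarget hs0 hsm
  have hpm := M.measurePreserving_fst_extTarget hm0 le_rfl
  have hrevs := M.measurePreserving_swap hs0 hsm
  have hrevm := M.measurePreserving_swap hm0 le_rfl
  have hfs : MemLp (fun z : X × (Fin s → ℝ≥0) => φ z.1) 2 (M.extTarget s hsm) :=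
    hφ.comp_measurePreserving hps
  have hfm : MemLp (fun z : X × (Fin m → ℝ≥0) => φ z.1) 2 (M.extTarget m le_rfl) :=
    hφ.comp_measurePreserving hpm
  have hs' : (0 : ℝ) < s := by exact_mod_cast hs
  have hκ : (1 : ℝ) ≤ m / s := by
    rw [one_le_div hs']
    exact_mod_cast hsm
  have hmeans := integral_comp_measurePreserving hps hφ.aestronglyMeasurable
  have hmeanm := integral_comp_measurePreserving hpm hφ.aestronglyMeasurable
  have hsq : AEStronglyMeasurable (fun x => (φ x - ∫ x, φ x ∂M.target) ^ 2) M.target :=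
    (hφ.aestronglyMeasurable.sub aestronglyMeasurable_const).pow 2
  rw [mul_div_assoc]
  refine exists_isAsymptoticVariance_le hrevs hrevm hfs hfm hκ hpos ?_ fun g hg hg2 => ?_
  · rw [hmeans, hmeanm]
    exact (integral_comp_measurePreserving hps hsq).trans
      (integral_comp_measurePreserving hpm hsq).symm
  · have hGm := PseudoMarginal.measurable_rotAvg hsm hg
    have hle := M.lintegral_rotAvg_sq_le hsm hs0 hg
    have hG2 : MemLp (PseudoMarginal.rotAvg hsm g) 2 (M.extTarget m le_rfl) :=
      memLp_two_of_lintegral_sq_le hGm.aestronglyMeasurable hg2 hle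
    refine ⟨PseudoMarginal.rotAvg hsm g, hG2, ?_, ?_, ?_⟩
    · rw [hmeans, hmeanm]
      have hint : Integrable (fun z : X × (Fin s → ℝ≥0) => (φ z.1 - ∫ x, φ x ∂M.target) * g z)
          (M.extTarget s hsm) := (hfs.sub (memLp_const _)).integrable_mul hg2
      rw [← M.integral_sum_rotProb_mul hsm hs0 hint]
      -- The factor in φ depends on x alone, which no rotation moves, so it comes out of the sum
      -- over windows.
      refine integral_congr_ae (Eventually.of_forall fun z => ?_)
      simp only [PseudoMarginal.rotAvg, Finset.mul_sum]
      exact Finset.sum_congr rfl fun k _ => mul_left_comm _ _ _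
    · have h := integral_sq_le_of_lintegral hGm.aestronglyMeasurable hg2 ENNReal.one_ne_top
        (by rwa [one_mul])
      rw [ENNReal.toReal_one] at h
      -- The norm bound holds with constant 1 and is weakened to m/s; the constant is dictated by
      -- the Dirichlet form.
      exact h.trans (mul_le_mul_of_nonneg_right hκ (integral_nonneg fun _ => sq_nonneg _))
    · have h1 : MemLp (fun p : (X × (Fin s → ℝ≥0)) × (X × (Fin s → ℝ≥0)) => g p.1) 2
          (M.extTarget s hsm ⊗ₘ M.kernel s hsm) :=
        hg2.comp_measurePreserving measurePreserving_fst_compProd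
      have h2 : MemLp (fun p : (X × (Fin s → ℝ≥0)) × (X × (Fin s → ℝ≥0)) => g p.2) 2
          (M.extTarget s hsm ⊗ₘ M.kernel s hsm) :=
        hg2.comp_measurePreserving (measurePreserving_snd_compProd hrevs)
      have h3 : Measurable fun p : (X × (Fin m → ℝ≥0)) × (X × (Fin m → ℝ≥0)) =>
          PseudoMarginal.rotAvg hsm g p.1 - PseudoMarginal.rotAvg hsm g p.2 :=
        (hGm.comp measurable_fst).sub (hGm.comp measurable_snd)
      have hc : (m / s : ℝ≥0∞) ≠ ∞ :=
        ENNReal.div_ne_top (ENNReal.natCast_ne_top m) (by exact_mod_cast hs0)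
      have h := integral_sq_le_of_lintegral h3.aestronglyMeasurable (h1.sub h2) hc
        (M.lintegral_rotAvg_sub_sq_le hsm hs0 hg)
      rwa [ENNReal.toReal_div, ENNReal.toReal_natCast, ENNReal.toReal_natCast] at h
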